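/- **Theorem 1.1.** Conventions. An increasing tableau is a filling of a Young diagram by positive integers whose rows and columns strictly increase and whose set of entries is an initial segment of $\{1,2,\dots\}$. For $n\ge 0$ and $k\ge 0$, $\mathrm{Inc}^{2\times n}_k$ is the set of increasing tableaux of shape $2\times n$ (two rows of length $n$) with maximum value $2n-k$. A small Schröder path of order $n$ is a lattice path from $(0,0)$ to $(2n,0)$ with upsteps $(1,1)$, downsteps $(1,-1)$ and horizontal steps $(2,0)$ that never falls below the horizontal axis and has no horizontal step on the axis; the $n$th small Schröder number is the number of such paths. For $T\in \mathrm{Inc}^{2\times n}_k$, $\mathrm{maj}(T)$ is the sum of all $i$ in the first row of $T$ such that $i+1$ appears in the second row. Finally $[m]_q=1+q+\cdots+q^{m-1}$, $[m]_q!=[1]_q[2]_q\cdots[m]_q$, and $\binom{a}{b}_q=\frac{[a]_q!}{[b]_q!\,[a-b]_q!}$ for $0\le b\le a$. (1) Let $0\le k<n$. The following maps are bijections. * From $\mathrm{Inc}^{2\times n}_k$ to the small Schröder paths of order $n$ with $k$ horizontal steps: $T$ is sent to the path whose $j$th step, for $1\le j\le 2n-k$, is an upstep if $j$ appears only in the first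 row of $T$, a downstep if $j$ appears only in the second row, and a horizontal step if $j$ appears in both rows. * From $\mathrm{Inc}^{2\times n}_k$ to the standard Young tableaux of shape $(n-k,n-k,1^k)$: let $A$ be the set of numbers that appear twice in $T$, and $B$ the set of numbers in the second row of $T$ immediately right of an element of $A$; $T$ is sent to the standard Young tableau whose first row is the first row of $T$ with $A$ deleted, whose second row is the second row of $T$ with $B$ deleted, and whose entries below the first two rows are the elements of $B$. Hence the small Schröder paths of order $n$ with $k$ horizontal steps are also in bijection with the standard Young tableaux of shape $(n-k,n-k,1^k)$, through the inverse of the first map followed by the second. (2) Let $0\le k<n$. Then $$\sum_{T\in \mathrm{Inc}^{2\times n}_k} q^{\mathrm{maj}(T)} = q^{\,n+\binom{k+1}{2}}\;\frac{\binom{n-1}{k}_q\,\binom{2n-k}{n-k-1}_q}{[n-k]_q}.$$ (3) If $k\ge n\ge 1$, then $\mathrm{Inc}^{2\times n}_k$ is empty and there is no small Schröder path of order $n$ with $k$ horizontal steps. (4) For every $n\ge 0$, the total number of increasing tableaux of shape $2\times n$ (over all maximum values) is finite and equals the $n$th small Schröder number. -/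

import Mathlib

/-! ### Increasing tableaux -/

/-- The set of entries of a tableau of shape `μ`. -/
def tabEntries {μ : YoungDiagram} (T : SemistandardYoungTableau μ) : Finset ℕ :=
  μ.cells.image fun c => T c.1 c.2

/-- The maximum value of a tableau (`0` for the empty tableau). -/
def maxValue {μ : YoungDiagram} (T : SemistandardYoungTableau μ) : ℕ :=
  μ.cells.sup fun c => T c.1 c.2

/-- A semistandard tableau (so its columns are strictly increasing) is increasing if its rows are
strictly increasing too and its set of entries is an initial segment of the positive integers. -/
def IsIncreasing {μ : YoungDiagram} (T : SemistandardYoungTableau μ) : Prop :=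
  (∀ i j₁ j₂ : ℕ, j₁ < j₂ → (i, j₂) ∈ μ → T i j₁ < T i j₂) ∧
    ∃ M : ℕ, tabEntries T = Finset.Icc 1 M

/-- The increasing tableaux of shape `μ`. -/
abbrev IncTableau (μ : YoungDiagram) : Type :=
  {T : SemistandardYoungTableau μ // IsIncreasing T}

/-- The increasing tableaux of shape `μ` with maximum value `|μ| - k`. -/
abbrev Inc (μ : YoungDiagram) (k : ℕ) : Type :=
  {T : SemistandardYoungTableau μ // IsIncreasing T ∧ maxValue T + k = μ.card}

/-- The standard Young tableaux of shape `μ`: each of `1, …, |μ|` is the entry of exactly one cell,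
and rows and columns increase (strictly along rows, because the entries are distinct). -/
abbrev SYT (μ : YoungDiagram) : Type :=
  {T : SemistandardYoungTableau μ //
    Set.BijOn (fun c : ℕ × ℕ => T c.1 c.2) (μ.cells : Set (ℕ × ℕ)) (Set.Icc 1 μ.card)}

/-- The set of entries in row `r`; rows are numbered from `0`. -/
def rowEntries {μ : YoungDiagram} (T : SemistandardYoungTableau μ) (r : ℕ) : Finset ℕ :=
  (μ.row r).image fun c => T c.1 c.2

/-- The sum of all `i` in the top row such that `i + 1` appears in the second row. -/
def maj {μ : YoungDiagram} (T : SemistandardYoungTableau μ) : ℕ :=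
  ∑ i ∈ (rowEntries T 0).filter (fun i => i + 1 ∈ rowEntries T 1), i

/-- The rectangle `2 × n`, that is, the partition `(n, n)`. -/
def twoRow (n : ℕ) : YoungDiagram :=
  YoungDiagram.ofRowLens [n, n] (by simp [List.sortedGE_iff_pairwise])

/-- The partition `(n - k, n - k, 1, …, 1)` with `k` ones. -/
def flagShape (n k : ℕ) (h : k < n) : YoungDiagram :=
  YoungDiagram.ofRowLens ((n - k) :: (n - k) :: List.replicate k 1) (by
    have h1 : 1 ≤ n - k := by omega
    simp only [List.sortedGE_iff_pairwise, List.pairwise_cons, List.mem_cons, List.mem_replicate,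
      List.pairwise_replicate]
    refine ⟨?_, ?_, Or.inr le_rfl⟩
    · rintro a (rfl | ⟨-, rfl⟩)
      · exact le_rfl
      · exact h1
    · rintro a ⟨-, rfl⟩
      exact h1)

/-- There are finitely many increasing tableaux of a given shape and maximum value. -/
instance finite_inc (μ : YoungDiagram) (k : ℕ) : Finite (Inc μ k) := by
  let F : Inc μ k → (μ.cells → Fin (μ.card + 1)) := fun T c =>
    ⟨T.1 c.1.1 c.1.2, by
      have h1 : T.1 c.1.1 c.1.2 ≤ maxValue T.1 :=
        Finset.le_sup (f := fun c : ℕ × ℕ => T.1 c.1 c.2) c.2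
      have h2 := T.2.2
      omega⟩
  refine Finite.of_injective F ?_
  intro T T' h
  apply Subtype.ext
  apply SemistandardYoungTableau.ext
  intro i j
  by_cases hc : (i, j) ∈ μ
  · exact congrArg Fin.val (congrFun h ⟨(i, j), hc⟩)
  · rw [T.1.zeros hc, T'.1.zeros hc]

noncomputable instance fintype_inc (μ : YoungDiagram) (k : ℕ) : Fintype (Inc μ k) :=
  Fintype.ofFinite _

/-! ### Small Schröder paths -/

/-- The three types of line segment of a Schröder path. -/
inductive PathStep where
  | up : PathStep
  | down : PathStep
  | horizontal : PathStep
  deriving DecidableEq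

/-- The displacement of a segment. -/
def PathStep.vec : PathStep → ℤ × ℤ
  | .up => (1, 1)
  | .down => (1, -1)
  | .horizontal => (2, 0)

/-- The point reached from the origin after the first `i` segments. -/
def pathPoint (p : List PathStep) (i : ℕ) : ℤ × ℤ :=
  ((p.take i).map PathStep.vec).sum

/-- The path from the origin with list of segments `p` is a small Schröder path to `(2n, 0)`: it
ends there, never falls below the horizontal axis (segments are straight, so it suffices to look at
the points between them), and has no horizontal segment on the axis. -/
structure IsSmallSchroder (n : ℕ) (p : List PathStep) : Prop where
  ends : pathPoint p p.length = (2 * (n : ℤ), 0)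
  nonneg : ∀ i ≤ p.length, 0 ≤ (pathPoint p i).2
  off_axis : ∀ i < p.length, p[i]? = some PathStep.horizontal → (pathPoint p i).2 ≠ 0

/-- The small Schröder paths from the origin to `(2n, 0)`. -/
abbrev SchroderPath (n : ℕ) : Type := {p : List PathStep // IsSmallSchroder n p}

/-- The small Schröder paths from the origin to `(2n, 0)` with `k` horizontal steps. -/
abbrev SchroderPathWith (n k : ℕ) : Type :=
  {p : List PathStep // IsSmallSchroder n p ∧ p.count PathStep.horizontal = k}

/-- The `n`th small Schröder number, defined as the number of small Schröder paths to `(2n, 0)`. -/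
noncomputable def schroderNumber (n : ℕ) : ℕ := Nat.card (SchroderPath n)

/-! ### The data of the explicit bijections -/

/-- The type of the `j`th segment of the path of a two-row tableau in which `j` appears: horizontal
if `j` is in both rows, an upstep if it is only in the first, a downstep if only in the second. -/
def segmentOf {μ : YoungDiagram} (T : SemistandardYoungTableau μ) (j : ℕ) : PathStep :=
  if j ∈ rowEntries T 0 then
    if j ∈ rowEntries T 1 then PathStep.horizontal else PathStep.up
  else PathStep.down

/-- The segments of the path of a two-row tableau, for `j = 1, 2, …, M` with `M` the maximum
value of the tableau. -/
def segments {μ : YoungDiagram} (T : SemistandardYoungTableau μ) : List PathStep :=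
  (List.range' 1 (maxValue T)).map (segmentOf T)

/-- The set `A` of numbers that appear twice in a two-row increasing tableau. -/
def doubled {μ : YoungDiagram} (T : SemistandardYoungTableau μ) : Finset ℕ :=
  rowEntries T 0 ∩ rowEntries T 1

/-- The set `B` of numbers that appear in the second row immediately right of an element of `A`. -/
def rightOfDoubled {μ : YoungDiagram} (T : SemistandardYoungTableau μ) : Finset ℕ :=
  ((μ.row 1).filter fun c => 1 ≤ c.2 ∧ T 1 (c.2 - 1) ∈ doubled T).image fun c => T c.1 c.2

/-- The set of entries of a tableau below its first two rows. -/
def lowerEntries {μ : YoungDiagram} (T : SemistandardYoungTableau μ) : Finset ℕ :=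
  (μ.cells.filter fun c => 2 ≤ c.1).image fun c => T c.1 c.2

/-- `S` arises from the two-row tableau `T` by deleting `A` from the first row and `B` from the
second row, and appending `B` to the first column. A standard tableau of shape
`(n - k, n - k, 1, …, 1)` is determined by its sets of entries in these three regions. -/
def IsFlagOf {μ ν : YoungDiagram} (T : SemistandardYoungTableau μ)
    (S : SemistandardYoungTableau ν) : Prop :=
  rowEntries S 0 = rowEntries T 0 \ doubled T ∧
    rowEntries S 1 = rowEntries T 1 \ rightOfDoubled T ∧
    lowerEntries S = rightOfDoubled T

/-! ### `q`-analogues, in the field of rational functions of `q` -/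

/-- `[m]_q = 1 + q + ⋯ + q ^ (m - 1)`. -/
noncomputable def qNum (m : ℕ) : RatFunc ℚ := ∑ i ∈ Finset.range m, RatFunc.X ^ i

/-- `[m]_q! = [1]_q [2]_q ⋯ [m]_q`. -/
noncomputable def qFact (m : ℕ) : RatFunc ℚ := ∏ i ∈ Finset.range m, qNum (i + 1)

/-- The `q`-binomial coefficient, which is `0` for `b > a`. -/
noncomputable def qBinom (a b : ℕ) : RatFunc ℚ :=
  if b ≤ a then qFact a / (qFact b * qFact (a - b)) else 0

/-!
A two-row tableau is determined by the sets `R` and `S` of entries of its rows, and it is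
column-strict exactly when each element of `S` is preceded by more elements of `R` than of `S`. Read
along the path, this says that before each segment that is not an upstep there have been more
upsteps than downsteps, which is the condition defining small Schröder paths.

For `x` in the second row, the elements of `B` up to `x` are as many as the elements of `A` strictly
before `x`, since the elements of `B` are the right neighbours of those of `A`. Hence deleting `A`
and `B` preserves the ballot condition, and `A` is recovered from `B` by taking left neighbours.

For the major index, initial parts of paths are built up one segment at a time. A new segment adds
the length of the path so far unless it is an upstep or follows a downstep, so it suffices to know
the generating function `F u d h` of the paths with `u` upsteps, `d` downsteps and `h` horizontal
steps and the generating function `D u d h` of those that end in a downstep. A final horizontal step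
adds as much as a final downstep, which removes the paths ending in a horizontal step from the
recurrences. With `G a b c` given by the `q`-hook formula for the shape `(a, b, 1, …, 1)` with `c`
ones, they are solved by `D u d h = G u d h - G (u - 1) d h` and
`F u d h = G u d h + G u (d + 1) (h - 1)`.
-/

/-! ### Enumeration of finite sets of natural numbers -/

section Enumeration

variable {R S : Finset ℕ} {i j x : ℕ}

theorem card_toFinset_mem (R : Finset ℕ) (hR : {x | x ∈ R}.Finite) :
    hR.toFinset.card = R.card := by
  congr 1
  ext x
  simp

theorem nth_mem_finset (hj : j < R.card) : Nat.nth (· ∈ R) j ∈ R :=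
  Nat.nth_mem (p := (· ∈ R)) j fun hR => by rwa [card_toFinset_mem]

theorem nth_lt_nth_finset (hij : i < j) (hj : j < R.card) :
    Nat.nth (· ∈ R) i < Nat.nth (· ∈ R) j :=
  Nat.nth_lt_nth' hij fun hR => by rwa [card_toFinset_mem]

theorem nth_finset_eq_zero (hj : R.card ≤ j) : Nat.nth (· ∈ R) j = 0 :=
  Nat.nth_of_card_le (p := (· ∈ R)) R.finite_toSet (by rwa [card_toFinset_mem])

theorem count_nth_finset (hj : j < R.card) : Nat.count (· ∈ R) (Nat.nth (· ∈ R) j) = j :=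
  Nat.count_nth fun hR => by rwa [card_toFinset_mem]

theorem exists_nth_finset (hx : x ∈ R) : ∃ j < R.card, Nat.nth (· ∈ R) j = x := by
  obtain ⟨j, hj, h⟩ := Nat.exists_lt_card_finite_nth_eq (p := (· ∈ R)) R.finite_toSet hx
  exact ⟨j, by rwa [card_toFinset_mem] at hj, h⟩

theorem image_nth_finset (R : Finset ℕ) : (Finset.range R.card).image (Nat.nth (· ∈ R)) = R := by
  ext x
  simp only [Finset.mem_image, Finset.mem_range]
  exact ⟨by rintro ⟨j, hj, rfl⟩; exact nth_mem_finset hj, exists_nth_finset⟩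

theorem count_finset_eq_card {m : ℕ} (h : ∀ x ∈ R, x < m) : Nat.count (· ∈ R) m = R.card := by
  rw [Nat.count_eq_card_filter_range]
  congr 1
  ext x
  simpa using h x

theorem card_image_range {f : ℕ → ℕ} {m : ℕ} (hf : StrictMonoOn f (Set.Iio m)) :
    ((Finset.range m).image f).card = m := by
  rw [Finset.card_image_of_injOn (by simpa using hf.injOn), Finset.card_range]

theorem nth_image_range {f : ℕ → ℕ} {m : ℕ} (hf : StrictMonoOn f (Set.Iio m)) (hj : j < m) :
    Nat.nth (· ∈ (Finset.range m).image f) j = f j := by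
  have hbelow : (Finset.range (f j)).filter (· ∈ (Finset.range m).image f) =
      (Finset.range j).image f := by
    ext x
    simp only [Finset.mem_filter, Finset.mem_range, Finset.mem_image]
    constructor
    · rintro ⟨hx, i, hi, rfl⟩
      exact ⟨i, (hf.lt_iff_lt hi hj).1 hx, rfl⟩
    · rintro ⟨i, hi, rfl⟩
      exact ⟨hf (hi.trans hj) hj hi, i, hi.trans hj, rfl⟩
  have hcount : Nat.count (· ∈ (Finset.range m).image f) (f j) = j := by
    rw [Nat.count_eq_card_filter_range, hbelow,
      card_image_range (hf.mono (Set.Iio_subset_Iio hj.le))]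
  conv_lhs => rw [← hcount]
  exact Nat.nth_count (p := (· ∈ (Finset.range m).image f))
    (Finset.mem_image_of_mem f (Finset.mem_range.2 hj))

/-- The ballot condition: each element of `S` is preceded by more elements of `R` than of `S`. This
is how column-strictness of a tableau with consecutive rows `R` and `S` reads on these two sets. -/
def IsBallot (R S : Finset ℕ) : Prop :=
  ∀ x ∈ S, Nat.count (· ∈ S) x < Nat.count (· ∈ R) x

theorem isBallot_iff_nth_lt_nth (hcard : S.card ≤ R.card) :
    IsBallot R S ↔ ∀ j < S.card, Nat.nth (· ∈ R) j < Nat.nth (· ∈ S) j := by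
  constructor
  · intro h j hj
    have hlt := h _ (nth_mem_finset hj)
    rw [count_nth_finset hj] at hlt
    exact Nat.nth_lt_of_lt_count hlt
  · intro h x hx
    obtain ⟨j, hj, rfl⟩ := exists_nth_finset hx
    have hlt := Nat.count_strict_mono (p := (· ∈ R)) (nth_mem_finset (hj.trans_le hcard)) (h j hj)
    rw [count_nth_finset hj]
    rwa [count_nth_finset (hj.trans_le hcard)] at hlt

end Enumeration

/-! ### Tableaux with strictly increasing rows -/

section RowStrict

variable {μ : YoungDiagram} {T T' : SemistandardYoungTableau μ}

/-- The rows of the tableau are strictly increasing. -/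
def IsRowStrict (T : SemistandardYoungTableau μ) : Prop :=
  ∀ i j₁ j₂ : ℕ, j₁ < j₂ → (i, j₂) ∈ μ → T i j₁ < T i j₂

theorem rowEntries_eq (T : SemistandardYoungTableau μ) (r : ℕ) :
    rowEntries T r = (Finset.range (μ.rowLen r)).image (T r) := by
  ext x
  simp [rowEntries, YoungDiagram.row_eq_prod]

theorem mem_rowEntries {r x : ℕ} : x ∈ rowEntries T r ↔ ∃ j, (r, j) ∈ μ ∧ T r j = x := by
  simp [rowEntries_eq, YoungDiagram.mem_iff_lt_rowLen]

theorem tabEntries_eq_union (T : SemistandardYoungTableau μ) :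
    tabEntries T = rowEntries T 0 ∪ rowEntries T 1 ∪ lowerEntries T := by
  ext x
  simp only [Finset.mem_union, mem_rowEntries, tabEntries, lowerEntries, Finset.mem_image,
    Finset.mem_filter, YoungDiagram.mem_cells, Prod.exists]
  constructor
  · rintro ⟨_ | _ | i, j, hc, rfl⟩
    · exact .inl (.inl ⟨j, hc, rfl⟩)
    · exact .inl (.inr ⟨j, hc, rfl⟩)
    · exact .inr ⟨i + 2, j, ⟨hc, by omega⟩, rfl⟩
  · rintro ((⟨j, hc, rfl⟩ | ⟨j, hc, rfl⟩) | ⟨i, j, ⟨hc, -⟩, rfl⟩) <;> exact ⟨_, j, hc, rfl⟩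

theorem maxValue_of_tabEntries_eq {m : ℕ} (h : tabEntries T = Finset.Icc 1 m) :
    maxValue T = m := by
  have hsup : maxValue T = (Finset.Icc 1 m).sup id := by
    rw [← h, tabEntries, Finset.sup_image]
    rfl
  rw [hsup]
  refine le_antisymm (Finset.sup_le fun x hx => (Finset.mem_Icc.1 hx).2) ?_
  rcases m.eq_zero_or_pos with rfl | hm
  · exact Nat.zero_le _
  · exact Finset.le_sup (f := id) (Finset.mem_Icc.2 ⟨hm, le_rfl⟩)

namespace IsRowStrict

theorem strictMonoOn (hT : IsRowStrict T) (r : ℕ) : StrictMonoOn (T r) (Set.Iio (μ.rowLen r)) :=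
  fun i _ j hj hij => hT r i j hij (YoungDiagram.mem_iff_lt_rowLen.2 hj)

theorem card_rowEntries (hT : IsRowStrict T) (r : ℕ) : (rowEntries T r).card = μ.rowLen r := by
  rw [rowEntries_eq, card_image_range (hT.strictMonoOn r)]

theorem nth_rowEntries (hT : IsRowStrict T) {r j : ℕ} (hj : j < μ.rowLen r) :
    Nat.nth (· ∈ rowEntries T r) j = T r j := by
  rw [rowEntries_eq, nth_image_range (hT.strictMonoOn r) hj]

theorem isBallot (hT : IsRowStrict T) (r : ℕ) :
    IsBallot (rowEntries T r) (rowEntries T (r + 1)) := by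
  have hlen : μ.rowLen (r + 1) ≤ μ.rowLen r := μ.rowLen_anti _ _ r.le_succ
  rw [isBallot_iff_nth_lt_nth (by rwa [hT.card_rowEntries, hT.card_rowEntries]),
    hT.card_rowEntries]
  intro j hj
  rw [hT.nth_rowEntries hj, hT.nth_rowEntries (hj.trans_le hlen)]
  exact T.col_strict r.lt_succ_self (YoungDiagram.mem_iff_lt_rowLen.2 hj)

theorem ext_rowEntries (hT : IsRowStrict T) (hT' : IsRowStrict T')
    (h : ∀ r, rowEntries T r = rowEntries T' r) : T = T' := by
  ext i j
  by_cases hc : (i, j) ∈ μ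
  · have hj := YoungDiagram.mem_iff_lt_rowLen.1 hc
    rw [← hT.nth_rowEntries hj, ← hT'.nth_rowEntries hj, h]
  · rw [T.zeros hc, T'.zeros hc]

end IsRowStrict

theorem exists_isRowStrict_of_isBallot {R : ℕ → Finset ℕ} (hcard : ∀ r, (R r).card = μ.rowLen r)
    (hR : ∀ r, IsBallot (R r) (R (r + 1))) :
    ∃ T : SemistandardYoungTableau μ, IsRowStrict T ∧ ∀ r, rowEntries T r = R r := by
  have hrow : ∀ i j₁ j₂, j₁ < j₂ → (i, j₂) ∈ μ → Nat.nth (· ∈ R i) j₁ < Nat.nth (· ∈ R i) j₂ :=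
    fun i j₁ j₂ hj hc =>
      nth_lt_nth_finset hj (by rwa [hcard, ← YoungDiagram.mem_iff_lt_rowLen])
  have hadj : ∀ i j, (i + 1, j) ∈ μ → Nat.nth (· ∈ R i) j < Nat.nth (· ∈ R (i + 1)) j := by
    intro i j hc
    refine (isBallot_iff_nth_lt_nth ?_).1 (hR i) j ?_
    · rw [hcard, hcard]
      exact μ.rowLen_anti _ _ i.le_succ
    · rwa [hcard, ← YoungDiagram.mem_iff_lt_rowLen]
  have hcol : ∀ i₁ i₂ j, i₁ < i₂ → (i₂, j) ∈ μ → Nat.nth (· ∈ R i₁) j < Nat.nth (· ∈ R i₂) j := by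
    intro i₁ i₂ j hi
    induction hi with
    | refl => exact hadj i₁ j
    | step _ ih =>
      exact fun hc => (ih (μ.up_left_mem (Nat.le_succ _) le_rfl hc)).trans (hadj _ j hc)
  refine ⟨⟨fun i j => Nat.nth (· ∈ R i) j, fun hj hc => (hrow _ _ _ hj hc).le, hcol _ _ _,
    fun {i j} hc => nth_finset_eq_zero ?_⟩, hrow, fun r => ?_⟩
  · rwa [hcard, ← not_lt, ← YoungDiagram.mem_iff_lt_rowLen]
  · rw [rowEntries_eq, ← hcard r]
    exact image_nth_finset (R r)

end RowStrict

/-! ### Increasing tableaux with two rows -/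

section TwoRow

variable {n m : ℕ} {R S : Finset ℕ} {T T' : SemistandardYoungTableau (twoRow n)}

theorem IsIncreasing.isRowStrict {μ : YoungDiagram} {T : SemistandardYoungTableau μ}
    (hT : IsIncreasing T) : IsRowStrict T :=
  hT.1

theorem IsIncreasing.tabEntries_eq {μ : YoungDiagram} {T : SemistandardYoungTableau μ}
    (hT : IsIncreasing T) : tabEntries T = Finset.Icc 1 (maxValue T) := by
  obtain ⟨-, m, hm⟩ := hT
  rw [maxValue_of_tabEntries_eq hm, hm]

theorem mem_twoRow {i j : ℕ} : (i, j) ∈ twoRow n ↔ i < 2 ∧ j < n := by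
  rw [twoRow, YoungDiagram.mem_ofRowLens]
  rcases i with _ | _ | i <;> simp

theorem rowLen_twoRow {r : ℕ} (hr : r < 2) : (twoRow n).rowLen r = n :=
  eq_of_forall_lt_iff fun j => by rw [← YoungDiagram.mem_iff_lt_rowLen, mem_twoRow]; simp [hr]

theorem card_twoRow (n : ℕ) : (twoRow n).card = 2 * n := by
  have hcells : (twoRow n).cells = Finset.range 2 ×ˢ Finset.range n := by
    ext ⟨i, j⟩
    simp [mem_twoRow]
  rw [YoungDiagram.card, hcells, Finset.card_product, Finset.card_range, Finset.card_range]

theorem rowEntries_twoRow_eq_empty (T : SemistandardYoungTableau (twoRow n)) (r : ℕ) :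
    rowEntries T (r + 2) = ∅ := by
  ext x
  simp [mem_rowEntries, mem_twoRow]

theorem tabEntries_twoRow (T : SemistandardYoungTableau (twoRow n)) :
    tabEntries T = rowEntries T 0 ∪ rowEntries T 1 := by
  have hlower : lowerEntries T = ∅ := by
    ext x
    simp only [lowerEntries, Finset.mem_image, Finset.mem_filter, YoungDiagram.mem_cells,
      Prod.exists, mem_twoRow, Finset.notMem_empty, iff_false]
    rintro ⟨i, j, ⟨⟨hi, -⟩, hi'⟩, -⟩
    omega
  rw [tabEntries_eq_union, hlower, Finset.union_empty]

/-- The pairs of sets that are the rows of an increasing tableau of shape `2 × n` with maximum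
value `m`. -/
structure IsRowPair (n m : ℕ) (R S : Finset ℕ) : Prop where
  card_left : R.card = n
  card_right : S.card = n
  union : R ∪ S = Finset.Icc 1 m
  isBallot : IsBallot R S

theorem IsIncreasing.isRowPair (hT : IsIncreasing T) :
    IsRowPair n (maxValue T) (rowEntries T 0) (rowEntries T 1) where
  card_left := by rw [hT.isRowStrict.card_rowEntries, rowLen_twoRow two_pos]
  card_right := by rw [hT.isRowStrict.card_rowEntries, rowLen_twoRow one_lt_two]
  union := by rw [← tabEntries_twoRow, hT.tabEntries_eq]
  isBallot := hT.isRowStrict.isBallot 0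

theorem IsIncreasing.ext_rows (hT : IsIncreasing T) (hT' : IsIncreasing T')
    (h0 : rowEntries T 0 = rowEntries T' 0) (h1 : rowEntries T 1 = rowEntries T' 1) : T = T' :=
  hT.isRowStrict.ext_rowEntries hT'.isRowStrict fun
    | 0 => h0
    | 1 => h1
    | r + 2 => by rw [rowEntries_twoRow_eq_empty, rowEntries_twoRow_eq_empty]

theorem IsRowPair.exists_tableau (h : IsRowPair n m R S) :
    ∃ T : SemistandardYoungTableau (twoRow n), IsIncreasing T ∧ maxValue T = m ∧
      rowEntries T 0 = R ∧ rowEntries T 1 = S := by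
  let rows : ℕ → Finset ℕ
    | 0 => R
    | 1 => S
    | _ + 2 => ∅
  obtain ⟨T, hT, hrows⟩ := exists_isRowStrict_of_isBallot (μ := twoRow n) (R := rows)
    (fun
      | 0 => by rw [rowLen_twoRow two_pos, ← h.card_left]
      | 1 => by rw [rowLen_twoRow one_lt_two, ← h.card_right]
      | r + 2 => .symm <| Nat.eq_zero_of_not_pos fun hr =>
        absurd (mem_twoRow.1 (YoungDiagram.mem_iff_lt_rowLen.2 hr)).1 (by omega))
    (fun
      | 0 => h.isBallot
      | _ + 1 => by simp [rows, IsBallot])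
  have htab : tabEntries T = Finset.Icc 1 m := by rw [tabEntries_twoRow, hrows, hrows, ← h.union]
  exact ⟨T, ⟨hT, m, htab⟩, maxValue_of_tabEntries_eq htab, hrows 0, hrows 1⟩

end TwoRow

/-! ### Small Schröder paths and increasing tableaux with two rows -/

open PathStep

section StaysAbove

variable {n : ℕ} {p : List PathStep} {s : PathStep}

/-- No segment of the path ends below the axis, and no horizontal one lies on it: before each
segment that is not an upstep there have been more upsteps than downsteps. -/
def StaysAbove (p : List PathStep) : Prop :=
  ∀ (i : ℕ) (hi : i < p.length), p[i] ≠ up → (p.take i).count down < (p.take i).count up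

theorem staysAbove_append_singleton :
    StaysAbove (p ++ [s]) ↔ StaysAbove p ∧ (s ≠ up → p.count down < p.count up) := by
  constructor
  · refine fun h => ⟨fun i hi hs => ?_, fun hs => ?_⟩
    · have hlt := h i (by simp; omega) (by rwa [List.getElem_append_left hi])
      rwa [List.take_append_of_le_length hi.le] at hlt
    · simpa using h p.length (by simp) (by simpa using hs)
  · rintro ⟨h, hlast⟩ i hi hs
    rcases (Nat.lt_succ_iff.1 (by simpa using hi)).lt_or_eq with hi' | rfl
    · rw [List.getElem_append_left hi'] at hs
      simpa only [List.take_append_of_le_length hi'.le] using h i hi' hs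
    · simpa using hlast (by simpa using hs)

theorem StaysAbove.take (h : StaysAbove p) (i : ℕ) : StaysAbove (p.take i) := by
  intro j hj hs
  have hj' := List.length_take ▸ hj
  rw [List.take_take, min_eq_left (by omega)]
  exact h j (by omega) (by rwa [List.getElem_take] at hs)

theorem StaysAbove.count_down_le (h : StaysAbove p) : p.count down ≤ p.count up := by
  induction p using List.reverseRecOn with
  | nil => rfl
  | append_singleton p s ih =>
    obtain ⟨hp, hs⟩ := staysAbove_append_singleton.1 h
    have hle := ih hp
    cases s <;> simp at hs ⊢ <;> omega

theorem StaysAbove.eq_nil (h : StaysAbove p) (hup : p.count up = 0) : p = [] := by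
  cases p with
  | nil => rfl
  | cons s p =>
    by_cases hs : s = up
    · simp [hs] at hup
    · simpa using h 0 (by simp) hs

theorem sum_map_vec (p : List PathStep) :
    (p.map PathStep.vec).sum =
      ((p.count up + p.count down + 2 * p.count horizontal : ℤ),
        (p.count up - p.count down : ℤ)) := by
  induction p with
  | nil => rfl
  | cons s p ih =>
    rw [List.map_cons, List.sum_cons, ih]
    cases s <;> ext <;> simp [PathStep.vec] <;> ring

theorem pathPoint_snd (p : List PathStep) (i : ℕ) :
    (pathPoint p i).2 = ((p.take i).count up - (p.take i).count down : ℤ) := by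
  rw [pathPoint, sum_map_vec]

theorem length_eq_count (p : List PathStep) :
    p.length = p.count up + p.count down + p.count horizontal := by
  induction p with
  | nil => rfl
  | cons s p ih => cases s <;> simp [ih] <;> omega

theorem IsSmallSchroder.staysAbove (hp : IsSmallSchroder n p) : StaysAbove p := by
  intro i hi hs
  have hnow := hp.nonneg i hi.le
  have hnext := hp.nonneg (i + 1) hi
  rw [pathPoint_snd] at hnow hnext
  rw [List.take_succ_eq_append_getElem hi] at hnext
  cases hstep : p[i] with
  | up => exact absurd hstep hs
  | down =>
    simp only [hstep, List.count_append, List.count_singleton, beq_iff_eq, reduceCtorEq, if_false,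
      if_true] at hnext
    omega
  | horizontal =>
    have hoff := hp.off_axis i hi (List.getElem?_eq_some_iff.2 ⟨hi, hstep⟩)
    rw [pathPoint_snd] at hoff
    omega

theorem isSmallSchroder_iff : IsSmallSchroder n p ↔
    StaysAbove p ∧ p.count up = p.count down ∧ p.count up + p.count horizontal = n := by
  have hends : pathPoint p p.length = (2 * (n : ℤ), 0) ↔
      p.count up = p.count down ∧ p.count up + p.count horizontal = n := by
    rw [pathPoint, List.take_length, sum_map_vec, Prod.mk.injEq]
    omega
  refine ⟨fun hp => ⟨hp.staysAbove, hends.1 hp.ends⟩, fun ⟨hp, hcount⟩ =>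
    ⟨hends.2 hcount, fun i _ => ?_, fun i hi hs => ?_⟩⟩
  · have hle := (hp.take i).count_down_le
    rw [pathPoint_snd]
    omega
  · obtain ⟨_, hstep⟩ := List.getElem?_eq_some_iff.1 hs
    have hlt := hp i hi (by simp [hstep])
    rw [pathPoint_snd]
    omega

theorem isEmpty_schroderPathWith {k : ℕ} (hn : 1 ≤ n) (hk : n ≤ k) :
    IsEmpty (SchroderPathWith n k) := by
  refine ⟨fun ⟨p, hp, hc⟩ => ?_⟩
  obtain ⟨habove, -, hcount⟩ := isSmallSchroder_iff.1 hp
  have hup : p.count up = 0 := by omega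
  have hhor : p.count horizontal = 0 := by simp [habove.eq_nil hup]
  omega

instance finite_pathStep : Finite PathStep :=
  Finite.of_surjective (![up, down, horizontal] : Fin 3 → PathStep) fun
    | up => ⟨0, rfl⟩
    | down => ⟨1, rfl⟩
    | horizontal => ⟨2, rfl⟩

instance finite_schroderPath (n : ℕ) : Finite (SchroderPath n) := by
  refine ((List.finite_length_le PathStep (2 * n)).subset fun p hp => ?_).to_subtype
  obtain ⟨-, hup, hn⟩ := isSmallSchroder_iff.1 hp
  have hlen := length_eq_count p
  change p.length ≤ 2 * n
  omega

end StaysAbove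

section RowPath

variable {n m i : ℕ} {R S : Finset ℕ}

/-- The type of the segment for the number `j` in the path of a tableau with rows `R` and `S`. -/
def rowSegment (R S : Finset ℕ) (j : ℕ) : PathStep :=
  if j ∈ R then if j ∈ S then horizontal else up else down

/-- The path of a tableau with rows `R` and `S` and maximum value `m`. -/
def rowPath (R S : Finset ℕ) (m : ℕ) : List PathStep :=
  (List.range' 1 m).map (rowSegment R S)

/-- The top row of the tableau of the path `p`; entries are counted from `1`, segments from `0`. -/
def upperRow (p : List PathStep) : Finset ℕ :=
  (Finset.Icc 1 p.length).filter fun j => p[j - 1]? ≠ some down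

/-- The second row of the tableau of the path `p`. -/
def lowerRow (p : List PathStep) : Finset ℕ :=
  (Finset.Icc 1 p.length).filter fun j => p[j - 1]? ≠ some up

theorem rowSegment_eq_down_iff {j : ℕ} : rowSegment R S j = down ↔ j ∉ R := by
  unfold rowSegment
  split_ifs <;> simp_all

theorem rowSegment_eq_up_iff {j : ℕ} (hj : j ∈ R ∪ S) : rowSegment R S j = up ↔ j ∉ S := by
  unfold rowSegment
  split_ifs <;> simp_all

theorem length_rowPath (R S : Finset ℕ) (m : ℕ) : (rowPath R S m).length = m := by
  simp [rowPath]

theorem getElem?_rowPath (hi : i < m) : (rowPath R S m)[i]? = some (rowSegment R S (i + 1)) := by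
  simp [rowPath, hi, add_comm]

theorem getElem?_pred_rowPath {j : ℕ} (hj : j ∈ Finset.Icc 1 m) :
    (rowPath R S m)[j - 1]? = some (rowSegment R S j) := by
  obtain ⟨hj1, hjm⟩ := Finset.mem_Icc.1 hj
  rw [getElem?_rowPath (by omega), Nat.sub_add_cancel hj1]

theorem rowPath_succ (R S : Finset ℕ) (m : ℕ) :
    rowPath R S (m + 1) = rowPath R S m ++ [rowSegment R S (m + 1)] := by
  simp [rowPath, List.range'_1_concat, add_comm]

theorem take_rowPath (hi : i ≤ m) : (rowPath R S m).take i = rowPath R S i := by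
  apply List.ext_getElem <;> simp [rowPath, hi]

theorem upperRow_rowPath (hU : R ∪ S = Finset.Icc 1 m) : upperRow (rowPath R S m) = R := by
  ext j
  rw [upperRow, Finset.mem_filter, length_rowPath]
  refine ⟨fun ⟨hj, h⟩ => ?_, fun hj => ?_⟩
  · rwa [getElem?_pred_rowPath hj, ne_eq, Option.some_inj, rowSegment_eq_down_iff, not_not] at h
  · have hj' := hU ▸ Finset.mem_union_left S hj
    rw [getElem?_pred_rowPath hj', ne_eq, Option.some_inj, rowSegment_eq_down_iff, not_not]
    exact ⟨hj', hj⟩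

theorem lowerRow_rowPath (hU : R ∪ S = Finset.Icc 1 m) : lowerRow (rowPath R S m) = S := by
  ext j
  rw [lowerRow, Finset.mem_filter, length_rowPath]
  refine ⟨fun ⟨hj, h⟩ => ?_, fun hj => ?_⟩
  · rwa [getElem?_pred_rowPath hj, ne_eq, Option.some_inj, rowSegment_eq_up_iff (hU ▸ hj),
      not_not] at h
  · have hj' := Finset.mem_union_right R hj
    rw [getElem?_pred_rowPath (hU ▸ hj'), ne_eq, Option.some_inj, rowSegment_eq_up_iff hj', not_not]
    exact ⟨hU ▸ hj', hj⟩

theorem upperRow_union_lowerRow (p : List PathStep) :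
    upperRow p ∪ lowerRow p = Finset.Icc 1 p.length := by
  rw [upperRow, lowerRow, ← Finset.filter_or, Finset.filter_true_of_mem]
  intro j _
  by_cases h : p[j - 1]? = some down
  · simp [h]
  · exact .inl h

theorem rowPath_upperRow_lowerRow (p : List PathStep) :
    rowPath (upperRow p) (lowerRow p) p.length = p := by
  refine List.ext_getElem (length_rowPath _ _ _) fun i hi hp => ?_
  rw [List.getElem_eq_iff, getElem?_rowPath hp]
  cases hstep : p[i] <;> simp [rowSegment, upperRow, lowerRow, hp, hstep]

theorem count_down_rowPath_add (hR : 0 ∉ R) (S : Finset ℕ) (i : ℕ) :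
    (rowPath R S i).count down + Nat.count (· ∈ R) (i + 1) = i := by
  induction i with
  | zero => simp [rowPath, Nat.count_succ, hR]
  | succ i ih =>
    rw [Nat.count_succ, rowPath_succ, List.count_append, List.count_singleton]
    by_cases h : i + 1 ∈ R <;> simp [rowSegment_eq_down_iff, h] <;> omega

theorem count_up_rowPath_add (hU : R ∪ S = Finset.Icc 1 m) (hi : i ≤ m) :
    (rowPath R S i).count up + Nat.count (· ∈ S) (i + 1) = i := by
  have hS : 0 ∉ S := fun h => by simpa [hU] using Finset.mem_union_right R h
  induction i with
  | zero => simp [rowPath, Nat.count_succ, hS]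
  | succ i ih =>
    have hmem : i + 1 ∈ R ∪ S := hU ▸ Finset.mem_Icc.2 ⟨by omega, hi⟩
    have ih := ih (by omega)
    rw [Nat.count_succ, rowPath_succ, List.count_append, List.count_singleton]
    by_cases h : i + 1 ∈ S <;> simp [rowSegment_eq_up_iff hmem, h] <;> omega

theorem isBallot_iff_staysAbove (hU : R ∪ S = Finset.Icc 1 m) :
    IsBallot R S ↔ StaysAbove (rowPath R S m) := by
  have hR : 0 ∉ R := fun h => by simpa [hU] using Finset.mem_union_left S h
  have hiff : ∀ i < m, (Nat.count (· ∈ S) (i + 1) < Nat.count (· ∈ R) (i + 1) ↔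
      ((rowPath R S m).take i).count down < ((rowPath R S m).take i).count up) := by
    intro i hi
    have hdown := count_down_rowPath_add hR S i
    have hup := count_up_rowPath_add hU hi.le
    rw [take_rowPath hi.le]
    omega
  have hstep : ∀ (i : ℕ) (hi : i < (rowPath R S m).length),
      (rowPath R S m)[i] ≠ up ↔ i + 1 ∈ S := by
    intro i hi
    have him : i < m := length_rowPath R S m ▸ hi
    have hmem : i + 1 ∈ R ∪ S := hU ▸ Finset.mem_Icc.2 ⟨by omega, him⟩
    rw [← not_iff_not, not_not, ← rowSegment_eq_up_iff hmem, List.getElem_eq_iff,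
      getElem?_rowPath him, Option.some_inj]
  constructor
  · intro h i hi hs
    exact (hiff i (length_rowPath R S m ▸ hi)).1 (h _ ((hstep i hi).1 hs))
  · intro h x hx
    obtain ⟨hx1, hxm⟩ := Finset.mem_Icc.1 (hU ▸ Finset.mem_union_right R hx)
    obtain ⟨i, rfl⟩ := Nat.exists_eq_add_of_le' hx1
    have hi : i < (rowPath R S m).length := by rwa [length_rowPath]
    exact (hiff i hxm).2 (h i hi ((hstep i hi).2 hx))

theorem isRowPair_iff (hU : R ∪ S = Finset.Icc 1 m) :
    IsRowPair n m R S ↔ IsSmallSchroder n (rowPath R S m) := by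
  have hlt : ∀ x ∈ R ∪ S, x < m + 1 := fun x hx => by
    rw [hU, Finset.mem_Icc] at hx
    omega
  have hR0 : 0 ∉ R := fun h => by simpa [hU] using Finset.mem_union_left S h
  have hdown := count_down_rowPath_add hR0 S m
  have hup := count_up_rowPath_add hU le_rfl
  have hlen := length_eq_count (rowPath R S m)
  rw [count_finset_eq_card fun x hx => hlt x (Finset.mem_union_left S hx)] at hdown
  rw [count_finset_eq_card fun x hx => hlt x (Finset.mem_union_right R hx)] at hup
  rw [length_rowPath] at hlen
  rw [isSmallSchroder_iff, ← isBallot_iff_staysAbove hU]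
  constructor
  · rintro ⟨hR, hS, -, hballot⟩
    exact ⟨hballot, by omega, by omega⟩
  · rintro ⟨hballot, hcount, hn⟩
    exact ⟨by omega, by omega, hU, hballot⟩

end RowPath

section Segments

variable {n : ℕ} {T : SemistandardYoungTableau (twoRow n)}

theorem segments_eq_rowPath {μ : YoungDiagram} (T : SemistandardYoungTableau μ) :
    segments T = rowPath (rowEntries T 0) (rowEntries T 1) (maxValue T) := rfl

theorem IsIncreasing.isSmallSchroder (hT : IsIncreasing T) : IsSmallSchroder n (segments T) :=
  (isRowPair_iff hT.isRowPair.union).1 hT.isRowPair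

theorem IsIncreasing.maxValue_add_count (hT : IsIncreasing T) :
    maxValue T + (segments T).count horizontal = (twoRow n).card := by
  obtain ⟨-, hcount, hn⟩ := isSmallSchroder_iff.1 hT.isSmallSchroder
  have hlen := length_eq_count (segments T)
  rw [segments_eq_rowPath, length_rowPath, ← segments_eq_rowPath] at hlen
  rw [card_twoRow]
  omega

theorem bijOn_segments (n : ℕ) :
    Set.BijOn segments {T : SemistandardYoungTableau (twoRow n) | IsIncreasing T}
      {p | IsSmallSchroder n p} := by
  refine ⟨fun T hT => IsIncreasing.isSmallSchroder hT, fun T hT T' hT' h => ?_, fun p hp => ?_⟩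
  · have hU := (IsIncreasing.isRowPair hT).union
    have hU' := (IsIncreasing.isRowPair hT').union
    rw [segments_eq_rowPath, segments_eq_rowPath] at h
    refine IsIncreasing.ext_rows hT hT' ?_ ?_
    · rw [← upperRow_rowPath hU, h, upperRow_rowPath hU']
    · rw [← lowerRow_rowPath hU, h, lowerRow_rowPath hU']
  · have hpair : IsRowPair n p.length (upperRow p) (lowerRow p) := by
      rwa [isRowPair_iff (upperRow_union_lowerRow p), rowPath_upperRow_lowerRow]
    obtain ⟨T, hT, hm, h0, h1⟩ := hpair.exists_tableau
    exact ⟨T, hT, by rw [segments_eq_rowPath, h0, h1, hm, rowPath_upperRow_lowerRow]⟩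

theorem bijOn_segments_with (n k : ℕ) :
    Set.BijOn segments
      {T : SemistandardYoungTableau (twoRow n) | IsIncreasing T ∧ maxValue T + k = (twoRow n).card}
      {p | IsSmallSchroder n p ∧ p.count horizontal = k} := by
  convert (bijOn_segments n).subset_right
    (r := {p | IsSmallSchroder n p ∧ p.count horizontal = k}) fun p hp => hp.1 using 1
  ext T
  refine ⟨fun ⟨hT, hk⟩ => ⟨hT, hT.isSmallSchroder, ?_⟩, fun ⟨hT, _, hk⟩ => ⟨hT, ?_⟩⟩
  · have h := hT.maxValue_add_count
    omega
  · rw [← hk]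
    exact IsIncreasing.maxValue_add_count hT

/-- The bijection from increasing tableaux with two rows to small Schröder paths. -/
noncomputable def schroderEquiv (n : ℕ) : IncTableau (twoRow n) ≃ SchroderPath n :=
  (bijOn_segments n).equiv segments

/-- The restriction of `schroderEquiv` to the paths with `k` horizontal steps. -/
noncomputable def schroderEquivWith (n k : ℕ) : Inc (twoRow n) k ≃ SchroderPathWith n k :=
  (bijOn_segments_with n k).equiv segments

end Segments

/-! ### The `q`-hook formula for the shapes `(a, b, 1, …, 1)` -/

section QAnalogues

theorem qNum_mul_sub (m : ℕ) : qNum m * (RatFunc.X - 1) = RatFunc.X ^ m - 1 :=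
  geom_sum_mul _ _

theorem ratFunc_X_pow_succ_sub_one_ne_zero (m : ℕ) :
    (RatFunc.X : RatFunc ℚ) ^ (m + 1) - 1 ≠ 0 := by
  have h : algebraMap (Polynomial ℚ) (RatFunc ℚ) (Polynomial.X ^ (m + 1) - 1) ≠ 0 := by
    rw [Ne, FaithfulSMul.algebraMap_eq_zero_iff]
    exact Polynomial.X_pow_sub_C_ne_zero m.succ_pos 1
  simpa using h

theorem qNum_eq (m : ℕ) : qNum m = (RatFunc.X ^ m - 1) * (RatFunc.X - 1)⁻¹ := by
  have hX : (RatFunc.X : RatFunc ℚ) - 1 ≠ 0 := by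
    simpa using ratFunc_X_pow_succ_sub_one_ne_zero 0
  rw [← qNum_mul_sub, mul_inv_cancel_right₀ hX]

@[simp] theorem qNum_succ_ne_zero (m : ℕ) : qNum (m + 1) ≠ 0 :=
  left_ne_zero_of_mul (qNum_mul_sub (m + 1) ▸ ratFunc_X_pow_succ_sub_one_ne_zero m)

@[simp] theorem qNum_zero : qNum 0 = 0 := by simp [qNum]

@[simp] theorem qFact_zero : qFact 0 = 1 := by simp [qFact]

theorem qFact_succ (m : ℕ) : qFact (m + 1) = qFact m * qNum (m + 1) :=
  Finset.prod_range_succ _ _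

@[simp] theorem qFact_ne_zero (m : ℕ) : qFact m ≠ 0 :=
  Finset.prod_ne_zero_iff.2 fun i _ => qNum_succ_ne_zero i

/-- The `q`-hook formula for the generating function of the major index over standard Young
tableaux of shape `(a, b, 1, …, 1)` with `c` ones, for `b ≤ a + 1`. The factor `[a + 1]_q - [b]_q`
stands for `q ^ b [a + 1 - b]_q`, without truncated subtraction; in the first case the common
factor `[b]_q` has been cancelled, because the formula of the second reads `0 / 0` at
`b = c = 0`. -/
noncomputable def flagGF (a b : ℕ) : ℕ → RatFunc ℚ
  | 0 => qFact (a + b) * (qNum (a + 1) - qNum b) / (qFact (a + 1) * qFact b)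
  | c + 1 => RatFunc.X ^ (c + 1 + (c + 2).choose 2) *
      (qFact (a + b + c + 1) * (qNum (a + 1) - qNum b) * qNum b /
        (qNum (a + c + 2) * qNum (b + c + 1) * (qFact a * qFact b * qFact (c + 1))))

theorem flagGF_self_succ (a c : ℕ) : flagGF a (a + 1) c = 0 := by
  cases c <;> simp [flagGF]

theorem flagGF_zero_right (a c : ℕ) : flagGF a 0 c = if c = 0 then 1 else 0 := by
  cases c <;> simp [flagGF, qFact_succ]

theorem flagGF_succ (a b c : ℕ) : flagGF a (b + 1) c = RatFunc.X ^ (c + (c + 1).choose 2) *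
    (qFact (a + b + c + 1) * (qNum (a + 1) - qNum (b + 1)) /
      (qNum (a + c + 1) * qNum (b + c + 1) * (qFact a * qFact b * qFact c))) := by
  cases c with
  | zero =>
    simp only [flagGF, qFact_succ, ← add_assoc, add_zero, qFact_zero, mul_one, zero_add,
      Nat.choose_eq_zero_of_lt one_lt_two, pow_zero, one_mul]
    field_simp (disch := simp)
  | succ c =>
    simp only [flagGF, ← add_assoc, add_right_comm _ 1 c, qFact_succ b]
    field_simp (disch := simp)

theorem flagGF_rec_zero (a b : ℕ) :
    flagGF (a + 1) (b + 1) 0 = flagGF a (b + 1) 0 + (flagGF (a + 1) b 0 - flagGF a b 0) +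
      RatFunc.X ^ (a + 1 + b) * flagGF a b 0 := by
  simp only [flagGF, ← add_assoc, add_right_comm _ 1 b, qFact_succ]
  field_simp (disch := simp)
  simp only [qNum_eq]
  ring

theorem flagGF_rec_succ (a b c : ℕ) :
    flagGF (a + 1) (b + 1) (c + 1) =
      flagGF a (b + 1) (c + 1) + (flagGF (a + 1) b (c + 1) - flagGF a b (c + 1)) +
        RatFunc.X ^ (a + 1 + b + (c + 1)) * (flagGF a b (c + 1) + flagGF (a + 1) (b + 1) c) := by
  have hchoose : (c + 2).choose 2 = c + 1 + (c + 1).choose 2 := by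
    rw [Nat.choose_succ_succ' (c + 1) 1, Nat.choose_one_right]
  rw [flagGF_succ (a + 1) b c]
  simp only [flagGF, ← add_assoc, add_right_comm _ 1 b, add_right_comm _ 1 c,
    qFact_succ, hchoose]
  field_simp (disch := simp)
  simp only [qNum_eq]
  ring

theorem flagGF_square {n k : ℕ} (h : k < n) : flagGF (n - k) (n - k) k =
    RatFunc.X ^ (n + (k + 1).choose 2) *
      (qBinom (n - 1) k * qBinom (2 * n - k) (n - k - 1) / qNum (n - k)) := by
  obtain ⟨m, rfl⟩ := Nat.exists_eq_add_of_lt h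
  have hdiff : qNum (m + 1 + 1) - qNum (m + 1) = RatFunc.X ^ (m + 1) := by
    rw [qNum, Finset.sum_range_succ, ← qNum, add_sub_cancel_left]
  rw [show k + m + 1 - k = m + 1 by omega, flagGF_succ, hdiff, Nat.add_sub_cancel,
    Nat.add_sub_cancel, qBinom, if_pos (by omega), qBinom, if_pos (by omega),
    show k + m - k = m by omega, show 2 * (k + m + 1) - k - m = k + m + 1 + 1 by omega,
    show m + 1 + m + k + 1 = 2 * (k + m + 1) - k by omega,
    show m + 1 + k + 1 = k + m + 1 + 1 by omega, show m + k + 1 = k + m + 1 by omega]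
  simp only [qFact_succ]
  field_simp (disch := simp)
  ring

end QAnalogues

/-! ### The major index of a path and its generating function -/

section PathMaj

variable {p : List PathStep} {s : PathStep}

/-- The major index of a path: that of the tableau with rows `upperRow p` and `lowerRow p`. -/
def pathMaj (p : List PathStep) : ℕ :=
  ∑ j ∈ (upperRow p).filter (· + 1 ∈ lowerRow p), j

theorem IsIncreasing.pathMaj_segments {n : ℕ} {T : SemistandardYoungTableau (twoRow n)}
    (hT : IsIncreasing T) : pathMaj (segments T) = maj T := by
  have hU := hT.isRowPair.union
  rw [pathMaj, segments_eq_rowPath, upperRow_rowPath hU, lowerRow_rowPath hU, maj]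

theorem pathMaj_eq_sum_range (p : List PathStep) : pathMaj p =
    ∑ j ∈ Finset.range p.length, if j ∈ upperRow p ∧ j + 1 ∈ lowerRow p then j else 0 := by
  rw [pathMaj, ← Finset.sum_filter]
  refine Finset.sum_congr (Finset.ext fun j => ?_) fun _ _ => rfl
  simp only [Finset.mem_filter, Finset.mem_range, iff_and_self]
  exact fun h => (Finset.mem_Icc.1 (Finset.mem_filter.1 h.2).1).2

theorem upperRow_append_singleton_of_le {j : ℕ} (hj : j ≤ p.length) :
    j ∈ upperRow (p ++ [s]) ↔ j ∈ upperRow p := by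
  rcases j with _ | j
  · simp [upperRow]
  · simp [upperRow, List.getElem?_append_left hj, hj, hj.trans p.length.le_succ]

theorem lowerRow_append_singleton_of_le {j : ℕ} (hj : j ≤ p.length) :
    j ∈ lowerRow (p ++ [s]) ↔ j ∈ lowerRow p := by
  rcases j with _ | j
  · simp [lowerRow]
  · simp [lowerRow, List.getElem?_append_left hj, hj, hj.trans p.length.le_succ]

theorem pathMaj_append_singleton (p : List PathStep) (s : PathStep) :
    pathMaj (p ++ [s]) =
      pathMaj p + if s ≠ up ∧ p.getLast? ≠ some down then p.length else 0 := by
  rw [pathMaj_eq_sum_range, pathMaj_eq_sum_range, List.length_append, List.length_singleton,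
    Finset.sum_range_succ]
  congr 1
  · refine Finset.sum_congr rfl fun j hj => ?_
    have hj := Finset.mem_range.1 hj
    simp only [upperRow_append_singleton_of_le hj.le, lowerRow_append_singleton_of_le hj]
  · simp only [upperRow_append_singleton_of_le le_rfl]
    rcases p.eq_nil_or_concat with rfl | ⟨q, t, rfl⟩
    · simp
    · simp [upperRow, lowerRow, and_comm]

end PathMaj

section GeneratingFunction

variable {u d h : ℕ} {s : PathStep}

/-- The generating function of the major index over a finite set of paths. -/
noncomputable def majGF (P : Set (List PathStep)) : RatFunc ℚ :=
  ∑ᶠ p ∈ P, RatFunc.X ^ pathMaj p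

/-- The initial parts of small Schröder paths, with `u` upsteps, `d` downsteps and `h` horizontal
steps. -/
def partialPaths (u d h : ℕ) : Set (List PathStep) :=
  {p | StaysAbove p ∧ p.count up = u ∧ p.count down = d ∧ p.count horizontal = h}

/-- The paths in `partialPaths u d h` whose last segment is `s`. -/
def partialPathsEndingIn (s : PathStep) (u d h : ℕ) : Set (List PathStep) :=
  {p ∈ partialPaths u d h | p.getLast? = some s}

theorem length_of_mem_partialPaths {p : List PathStep} (hp : p ∈ partialPaths u d h) :
    p.length = u + d + h := by
  obtain ⟨-, rfl, rfl, rfl⟩ := hp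
  exact length_eq_count p

theorem finite_partialPaths (u d h : ℕ) : (partialPaths u d h).Finite :=
  (List.finite_length_eq PathStep (u + d + h)).subset fun _ hp => length_of_mem_partialPaths hp

theorem finite_partialPathsEndingIn (s : PathStep) (u d h : ℕ) :
    (partialPathsEndingIn s u d h).Finite :=
  (finite_partialPaths u d h).subset fun _ hp => hp.1

theorem partialPaths_eq_empty (hud : u < d) : partialPaths u d h = ∅ := by
  refine Set.eq_empty_of_forall_notMem fun p ⟨hp, hu, hd, _⟩ => ?_
  have hle := hp.count_down_le
  omega

theorem partialPathsEndingIn_eq_empty (hud : u < d) : partialPathsEndingIn s u d h = ∅ :=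
  Set.subset_eq_empty (fun _ hp => hp.1) (partialPaths_eq_empty hud)

theorem partialPathsEndingIn_down_zero (u h : ℕ) : partialPathsEndingIn down u 0 h = ∅ :=
  Set.eq_empty_of_forall_notMem fun _ ⟨⟨_, _, hd, _⟩, hlast⟩ =>
    List.count_eq_zero.1 hd (List.mem_of_getLast? hlast)

theorem partialPathsEndingIn_horizontal_zero (u d : ℕ) :
    partialPathsEndingIn horizontal u d 0 = ∅ :=
  Set.eq_empty_of_forall_notMem fun _ ⟨⟨_, _, _, hh⟩, hlast⟩ =>
    List.count_eq_zero.1 hh (List.mem_of_getLast? hlast)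

theorem partialPaths_zero_succ (h : ℕ) : partialPaths 0 0 (h + 1) = ∅ := by
  refine Set.eq_empty_of_forall_notMem fun p ⟨hp, hu, _, hh⟩ => ?_
  simp [hp.eq_nil hu] at hh

theorem partialPaths_zero : partialPaths 0 0 0 = {[]} := by
  ext p
  refine ⟨fun ⟨hp, hu, _⟩ => hp.eq_nil hu, ?_⟩
  rintro rfl
  exact ⟨fun i hi => by simp at hi, rfl, rfl, rfl⟩

theorem majGF_empty : majGF ∅ = 0 := finsum_mem_empty

theorem majGF_union {P Q : Set (List PathStep)} (hP : P.Finite) (hQ : Q.Finite)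
    (hPQ : Disjoint P Q) : majGF (P ∪ Q) = majGF P + majGF Q :=
  finsum_mem_union hPQ hP hQ

theorem majGF_partialPaths_succ (u d h : ℕ) :
    majGF (partialPaths (u + 1) d h) = majGF (partialPathsEndingIn up (u + 1) d h) +
      majGF (partialPathsEndingIn down (u + 1) d h) +
      majGF (partialPathsEndingIn horizontal (u + 1) d h) := by
  have hunion : partialPaths (u + 1) d h = partialPathsEndingIn up (u + 1) d h ∪
      partialPathsEndingIn down (u + 1) d h ∪ partialPathsEndingIn horizontal (u + 1) d h := by
    ext p
    refine ⟨fun hp => ?_, ?_⟩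
    · rcases p.eq_nil_or_concat with rfl | ⟨q, _ | _ | _, rfl⟩
      · simpa using hp.2.1
      · exact .inl (.inl ⟨hp, by simp⟩)
      · exact .inl (.inr ⟨hp, by simp⟩)
      · exact .inr ⟨hp, by simp⟩
    · rintro ((hp | hp) | hp) <;> exact hp.1
  have hdisj : ∀ {s t}, s ≠ t → Disjoint (partialPathsEndingIn s (u + 1) d h)
      (partialPathsEndingIn t (u + 1) d h) := fun hst => Set.disjoint_left.2 fun p hp hp' =>
    hst (Option.some_inj.1 (hp.2.symm.trans hp'.2))
  have hfin := fun s => finite_partialPathsEndingIn s (u + 1) d h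
  rw [hunion, majGF_union ((hfin _).union (hfin _)) (hfin _)
    (Set.disjoint_union_left.2 ⟨hdisj (by simp), hdisj (by simp)⟩),
    majGF_union (hfin _) (hfin _) (hdisj (by simp))]

theorem partialPathsEndingIn_eq_image (s : PathStep) (u d h : ℕ) :
    partialPathsEndingIn s (u + [s].count up) (d + [s].count down) (h + [s].count horizontal) =
      (· ++ [s]) '' {p ∈ partialPaths u d h | s ≠ up → d < u} := by
  ext p
  rcases p.eq_nil_or_concat with rfl | ⟨q, t, rfl⟩
  · simp [partialPathsEndingIn]
  · simp only [partialPathsEndingIn, partialPaths, Set.mem_ofPred_eq, Set.mem_image,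
      List.concat_eq_append, List.getLast?_concat, Option.some_inj]
    constructor
    · rintro ⟨⟨hq, hu, hd, hh⟩, rfl⟩
      simp only [List.count_append, add_left_inj] at hu hd hh
      obtain ⟨hq, ht⟩ := staysAbove_append_singleton.1 hq
      exact ⟨q, ⟨⟨hq, hu, hd, hh⟩, by rwa [hu, hd] at ht⟩, rfl⟩
    · rintro ⟨q', ⟨⟨hq, rfl, rfl, rfl⟩, ht⟩, hqt⟩
      obtain ⟨rfl, hts⟩ := List.append_inj' hqt rfl
      obtain rfl := List.singleton_inj.1 hts
      exact ⟨⟨staysAbove_append_singleton.2 ⟨hq, ht⟩, List.count_append, List.count_append,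
        List.count_append⟩, rfl⟩

theorem majGF_image_append_singleton (s : PathStep) (P : Set (List PathStep)) :
    majGF ((· ++ [s]) '' P) = ∑ᶠ p ∈ P, RatFunc.X ^ pathMaj (p ++ [s]) :=
  finsum_mem_image (List.append_left_injective [s]).injOn

theorem majGF_partialPathsEndingIn_up (u d h : ℕ) :
    majGF (partialPathsEndingIn up (u + 1) d h) = majGF (partialPaths u d h) := by
  have himage := partialPathsEndingIn_eq_image up u d h
  simp only [List.count_singleton, beq_iff_eq, reduceCtorEq, if_false, if_true, add_zero, ne_eq,
    not_true_eq_false, false_imp_iff, and_true, Set.ofPred_mem_eq] at himage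
  rw [himage, majGF_image_append_singleton]
  simp [pathMaj_append_singleton, majGF]

theorem majGF_partialPathsEndingIn_horizontal (u d h : ℕ) :
    majGF (partialPathsEndingIn horizontal u d (h + 1)) =
      majGF (partialPathsEndingIn down u (d + 1) h) := by
  have hhor := partialPathsEndingIn_eq_image horizontal u d h
  have hdown := partialPathsEndingIn_eq_image down u d h
  simp only [List.count_singleton, beq_iff_eq, reduceCtorEq, if_false, if_true, add_zero]
    at hhor hdown
  rw [hhor, hdown, majGF_image_append_singleton, majGF_image_append_singleton]
  simp [pathMaj_append_singleton]

theorem majGF_partialPathsEndingIn_down_succ (hdu : d < u) (h : ℕ) :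
    majGF (partialPathsEndingIn down u (d + 1) h) = majGF (partialPathsEndingIn down u d h) +
      RatFunc.X ^ (u + d + h) *
        (majGF (partialPaths u d h) - majGF (partialPathsEndingIn down u d h)) := by
  have himage := partialPathsEndingIn_eq_image down u d h
  simp only [List.count_singleton, beq_iff_eq, reduceCtorEq, if_false, if_true, add_zero, ne_eq,
    not_false_eq_true, true_imp_iff, hdu, and_true, Set.ofPred_mem_eq] at himage
  set D := partialPathsEndingIn down u d h
  set E := partialPaths u d h \ D
  have hsplit : partialPaths u d h = D ∪ E := (Set.union_sdiff_cancel fun _ hp => hp.1).symm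
  have hD : D.Finite := finite_partialPathsEndingIn down u d h
  have hE : E.Finite := (finite_partialPaths u d h).sdiff
  have hDE : Disjoint D E := Set.disjoint_sdiff_right
  have hmajD : ∀ p ∈ D, pathMaj (p ++ [down]) = pathMaj p := fun p hp => by
    simp [pathMaj_append_singleton, hp.2]
  have hmajE : ∀ p ∈ E, pathMaj (p ++ [down]) = u + d + h + pathMaj p := fun p hp => by
    have hlast : p.getLast? ≠ some down := fun hs => hp.2 ⟨hp.1, hs⟩
    simp [pathMaj_append_singleton, hlast, length_of_mem_partialPaths hp.1, add_comm]
  rw [himage, hsplit, majGF_union hD hE hDE, add_sub_cancel_left, majGF_image_append_singleton,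
    finsum_mem_union hDE hD hE, majGF, majGF, mul_finsum_mem]
  congr 1
  · exact finsum_mem_congr rfl fun p hp => by rw [hmajD p hp]
  · exact finsum_mem_congr rfl fun p hp => by rw [hmajE p hp, pow_add]

/-- The generating function of the major index over `partialPaths u d h`, for `d ≤ u`. -/
noncomputable def partialGF (u d : ℕ) : ℕ → RatFunc ℚ
  | 0 => flagGF u d 0
  | h + 1 => flagGF u d (h + 1) + flagGF u (d + 1) h

theorem majGF_partialPaths_succ_zero (u d : ℕ) :
    majGF (partialPaths (u + 1) d 0) =
      majGF (partialPaths u d 0) + majGF (partialPathsEndingIn down (u + 1) d 0) := by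
  rw [majGF_partialPaths_succ, majGF_partialPathsEndingIn_up,
    partialPathsEndingIn_horizontal_zero, majGF_empty, add_zero]

theorem majGF_partialPaths_succ_succ (u d h : ℕ) :
    majGF (partialPaths (u + 1) d (h + 1)) =
      majGF (partialPaths u d (h + 1)) + majGF (partialPathsEndingIn down (u + 1) d (h + 1)) +
        majGF (partialPathsEndingIn down (u + 1) (d + 1) h) := by
  rw [majGF_partialPaths_succ, majGF_partialPathsEndingIn_up, majGF_partialPathsEndingIn_horizontal]

theorem majGF_partialPathsEndingIn_down {u : ℕ}
    (hu : ∀ d ≤ u, ∀ h, majGF (partialPaths u d h) = partialGF u d h) {d : ℕ} (hd : d ≤ u + 1)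
    (h : ℕ) :
    majGF (partialPathsEndingIn down (u + 1) d h) = flagGF (u + 1) d h - flagGF u d h := by
  induction h generalizing d with
  | zero =>
    induction d with
    | zero =>
      rw [partialPathsEndingIn_down_zero, majGF_empty, flagGF_zero_right, flagGF_zero_right,
        sub_self]
    | succ d ih =>
      rw [majGF_partialPathsEndingIn_down_succ hd, majGF_partialPaths_succ_zero, ih (by omega),
        hu d (by omega), flagGF_rec_zero, partialGF]
      ring
  | succ h ihh =>
    induction d with
    | zero =>
      rw [partialPathsEndingIn_down_zero, majGF_empty, flagGF_zero_right, flagGF_zero_right,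
        sub_self]
    | succ d ih =>
      rw [majGF_partialPathsEndingIn_down_succ hd, majGF_partialPaths_succ_succ, ih (by omega),
        ihh hd, hu d (by omega), flagGF_rec_succ, partialGF]
      ring

theorem majGF_partialPaths (hdu : d ≤ u) (h : ℕ) :
    majGF (partialPaths u d h) = partialGF u d h := by
  induction u generalizing d h with
  | zero =>
    obtain rfl := Nat.le_zero.1 hdu
    cases h with
    | zero => simp [partialPaths_zero, majGF, partialGF, flagGF_zero_right, pathMaj, upperRow]
    | succ h =>
      rw [partialPaths_zero_succ, majGF_empty, partialGF, flagGF_zero_right, flagGF_self_succ]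
      simp
  | succ u ih =>
    have hdown := fun {d} => majGF_partialPathsEndingIn_down (d := d) fun d hd h => ih hd h
    rcases hdu.lt_or_eq with hdu | rfl
    · have hdu := Nat.le_of_lt_succ hdu
      cases h with
      | zero =>
        rw [majGF_partialPaths_succ_zero, ih hdu, hdown (by omega), partialGF, partialGF]
        ring
      | succ h =>
        rw [majGF_partialPaths_succ_succ, ih hdu, hdown (by omega), hdown (by omega), partialGF,
          partialGF]
        ring
    · cases h with
      | zero =>
        rw [majGF_partialPaths_succ_zero, partialPaths_eq_empty u.lt_succ_self, majGF_empty,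
          hdown le_rfl, flagGF_self_succ, partialGF]
        ring
      | succ h =>
        rw [majGF_partialPaths_succ_succ, partialPaths_eq_empty u.lt_succ_self,
          partialPathsEndingIn_eq_empty (u + 1).lt_succ_self, majGF_empty, hdown le_rfl,
          flagGF_self_succ, partialGF, flagGF_self_succ]
        ring

theorem isSmallSchroder_with_eq_partialPaths {n k : ℕ} (h : k < n) :
    {p | IsSmallSchroder n p ∧ p.count horizontal = k} = partialPaths (n - k) (n - k) k := by
  ext p
  rw [Set.mem_ofPred_eq, isSmallSchroder_iff, partialPaths, Set.mem_ofPred_eq]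
  constructor
  · rintro ⟨⟨hp, hcount, hn⟩, hh⟩
    exact ⟨hp, by omega, by omega, hh⟩
  · rintro ⟨hp, hu, hd, hh⟩
    exact ⟨⟨hp, by omega, by omega⟩, hh⟩

theorem sum_maj_eq {n k : ℕ} (h : k < n) :
    ∑ T : Inc (twoRow n) k, (RatFunc.X : RatFunc ℚ) ^ maj T.1 = flagGF (n - k) (n - k) k := by
  have hpaths : ∑ T : Inc (twoRow n) k, (RatFunc.X : RatFunc ℚ) ^ maj T.1 =
      majGF (partialPaths (n - k) (n - k) k) := by
    rw [← isSmallSchroder_with_eq_partialPaths h, majGF, ← finsum_eq_sum_of_fintype]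
    refine (finsum_subtype_eq_finsum_cond (f := fun T => RatFunc.X ^ maj T) _).trans ?_
    exact finsum_mem_eq_of_bijOn segments (bijOn_segments_with n k) fun T hT =>
      congrArg (RatFunc.X ^ ·) hT.1.pathMaj_segments.symm
  rw [hpaths, majGF_partialPaths le_rfl]
  obtain _ | k := k
  · rfl
  · rw [partialGF, flagGF_self_succ, add_zero]

end GeneratingFunction

/-! ### Deleting the doubled entries -/

section Neighbours

variable {X Y S : Finset ℕ} {x : ℕ}

/-- The elements of `S` immediately right of an element of `X`, when `S` is listed in increasing
order; `X` is meant to be a subset of `S`. -/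
def rightOf (X S : Finset ℕ) : Finset ℕ :=
  S.filter fun x => ∃ y ∈ X, Nat.count (· ∈ S) x = Nat.count (· ∈ S) y + 1

/-- The elements of `S` immediately left of an element of `X`, when `S` is listed in increasing
order; `X` is meant to be a subset of `S`. -/
def leftOf (X S : Finset ℕ) : Finset ℕ :=
  S.filter fun x => ∃ y ∈ X, Nat.count (· ∈ S) y = Nat.count (· ∈ S) x + 1

theorem mem_rightOf :
    x ∈ rightOf X S ↔ x ∈ S ∧ ∃ y ∈ X, Nat.count (· ∈ S) x = Nat.count (· ∈ S) y + 1 :=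
  Finset.mem_filter

theorem mem_leftOf :
    x ∈ leftOf X S ↔ x ∈ S ∧ ∃ y ∈ X, Nat.count (· ∈ S) y = Nat.count (· ∈ S) x + 1 :=
  Finset.mem_filter

theorem rightOf_subset (X S : Finset ℕ) : rightOf X S ⊆ S := Finset.filter_subset _ _

theorem leftOf_subset (X S : Finset ℕ) : leftOf X S ⊆ S := Finset.filter_subset _ _

theorem count_lt_card (hx : x ∈ S) : Nat.count (· ∈ S) x < S.card := by
  obtain ⟨j, hj, rfl⟩ := exists_nth_finset hx
  rwa [count_nth_finset hj]

theorem rightOf_leftOf (hX : X ⊆ S) (hfirst : ∀ x ∈ X, 0 < Nat.count (· ∈ S) x) :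
    rightOf (leftOf X S) S = X := by
  ext x
  simp only [mem_rightOf, mem_leftOf]
  constructor
  · rintro ⟨hx, y, ⟨-, z, hz, hzy⟩, hxy⟩
    rwa [Nat.count_injective (p := (· ∈ S)) hx (hX hz) (hxy.trans hzy.symm)]
  · intro hx
    obtain ⟨j, hj⟩ := Nat.exists_eq_add_of_lt (hfirst x hx)
    rw [zero_add] at hj
    have hlt : j < S.card := by
      have := count_lt_card (hX hx)
      omega
    have hcount := count_nth_finset hlt
    exact ⟨hX hx, Nat.nth (· ∈ S) j, ⟨nth_mem_finset hlt, x, hx, by omega⟩, by omega⟩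

theorem leftOf_rightOf (hX : X ⊆ S) (hlast : ∀ x ∈ X, Nat.count (· ∈ S) x + 1 < S.card) :
    leftOf (rightOf X S) S = X := by
  ext x
  simp only [mem_rightOf, mem_leftOf]
  constructor
  · rintro ⟨hx, y, ⟨-, z, hz, hyz⟩, hyx⟩
    rwa [Nat.count_injective (p := (· ∈ S)) hx (hX hz) (by omega)]
  · intro hx
    have hlt := hlast x hx
    have hcount := count_nth_finset hlt
    exact ⟨hX hx, _, ⟨nth_mem_finset hlt, x, hx, hcount⟩, hcount⟩

theorem card_rightOf (hX : X ⊆ S) (hlast : ∀ x ∈ X, Nat.count (· ∈ S) x + 1 < S.card) :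
    (rightOf X S).card = X.card := by
  have himage : (rightOf X S).image (Nat.count (· ∈ S)) =
      X.image fun x => Nat.count (· ∈ S) x + 1 := by
    ext j
    simp only [Finset.mem_image, mem_rightOf]
    constructor
    · rintro ⟨x, ⟨-, y, hy, hxy⟩, rfl⟩
      exact ⟨y, hy, hxy.symm⟩
    · rintro ⟨y, hy, rfl⟩
      have hcount := count_nth_finset (hlast y hy)
      exact ⟨_, ⟨nth_mem_finset (hlast y hy), y, hy, hcount⟩, hcount⟩
  have hinj : Set.InjOn (Nat.count (· ∈ S)) S := fun x hx y hy h =>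
    Nat.count_injective (p := (· ∈ S)) hx hy h
  rw [← Finset.card_image_of_injOn (hinj.mono (rightOf_subset X S)), himage,
    Finset.card_image_of_injOn fun x hx y hy h => hinj (hX hx) (hX hy) (Nat.succ_injective h)]

theorem count_eq_card_filter (X : Finset ℕ) (x : ℕ) :
    Nat.count (· ∈ X) x = (X.filter (· < x)).card := by
  rw [Nat.count_eq_card_filter_range]
  congr 1
  ext y
  simp [and_comm]

theorem count_rightOf_succ (hX : X ⊆ S) (hx : x ∈ S) :
    Nat.count (· ∈ rightOf X S) (x + 1) = Nat.count (· ∈ X) x := by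
  have hlt : ∀ y ∈ S, (y < x ↔ Nat.count (· ∈ S) y < Nat.count (· ∈ S) x) := fun y hy =>
    ⟨Nat.count_strict_mono (p := (· ∈ S)) hy, fun h => Nat.lt_of_count_lt_count h⟩
  have hle : ∀ y ∈ S, (y ≤ x ↔ Nat.count (· ∈ S) y ≤ Nat.count (· ∈ S) x) := fun y _ =>
    ⟨fun h => Nat.count_monotone _ h, fun h => by
      by_contra! hxy
      exact h.not_gt (Nat.count_strict_mono (p := (· ∈ S)) hx hxy)⟩
  have hrestrict : (rightOf X S).filter (· < x + 1) = rightOf (X.filter (· < x)) S := by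
    ext z
    simp only [Finset.mem_filter, mem_rightOf, Nat.lt_succ_iff]
    constructor
    · rintro ⟨⟨hz, y, hy, hzy⟩, hzx⟩
      exact ⟨hz, y, ⟨hy, (hlt y (hX hy)).2 (by have := (hle z hz).1 hzx; omega)⟩, hzy⟩
    · rintro ⟨hz, y, ⟨hy, hyx⟩, hzy⟩
      exact ⟨⟨hz, y, hy, hzy⟩, (hle z hz).2 (by have := (hlt y (hX hy)).1 hyx; omega)⟩
  rw [count_eq_card_filter, count_eq_card_filter, hrestrict,
    card_rightOf ((Finset.filter_subset _ _).trans hX)]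
  intro y hy
  obtain ⟨hyX, hyx⟩ := Finset.mem_filter.1 hy
  have := (hlt y (hX hyX)).1 hyx
  have := count_lt_card hx
  omega

theorem count_sdiff_add (h : Y ⊆ X) (x : ℕ) :
    Nat.count (· ∈ X \ Y) x + Nat.count (· ∈ Y) x = Nat.count (· ∈ X) x := by
  have hfilter : (X \ Y).filter (· < x) = X.filter (· < x) \ Y.filter (· < x) := by
    ext y
    simp only [Finset.mem_filter, Finset.mem_sdiff]
    tauto
  simp only [count_eq_card_filter]
  rw [hfilter, Finset.card_sdiff_add_card_eq_card (Finset.filter_subset_filter _ h)]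

theorem IsBallot.count_le (h : IsBallot X Y) (x : ℕ) :
    Nat.count (· ∈ Y) x ≤ Nat.count (· ∈ X) x := by
  induction x with
  | zero => simp
  | succ x ih =>
    rw [Nat.count_succ, Nat.count_succ]
    by_cases hx : x ∈ Y
    · have := h x hx
      simp only [hx, if_true]
      omega
    · simp only [hx, if_false]
      omega

end Neighbours

section FlagTriple

variable {n k m m' : ℕ} {P Q L R S R' S' : Finset ℕ}

/-- The triples of sets that are the first row, the second row and the part below of a standard
tableau of shape `(n - k, n - k, 1, …, 1)` with `k` ones. -/
structure IsFlagTriple (n k : ℕ) (P Q L : Finset ℕ) : Prop where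
  card_left : P.card = n - k
  card_right : Q.card = n - k
  card_lower : L.card = k
  union : P ∪ Q ∪ L = Finset.Icc 1 (2 * n - k)
  isBallot : IsBallot P Q
  count_pos : ∀ x ∈ L, 0 < Nat.count (· ∈ Q) x

namespace IsRowPair

theorem card_inter (h : IsRowPair n m R S) (hk : m + k = 2 * n) : (R ∩ S).card = k := by
  have hcard := Finset.card_union_add_card_inter R S
  rw [h.union, Nat.card_Icc, h.card_left, h.card_right] at hcard
  omega

theorem count_succ_lt_of_mem_inter (h : IsRowPair n m R S) {x : ℕ} (hx : x ∈ R ∩ S) :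
    Nat.count (· ∈ S) x + 1 < S.card := by
  obtain ⟨hR, hS⟩ := Finset.mem_inter.1 hx
  have hballot := h.isBallot x hS
  have hlt := count_lt_card hR
  rw [h.card_left] at hlt
  rw [h.card_right]
  omega

theorem leftOf_rightOf_inter (h : IsRowPair n m R S) :
    leftOf (rightOf (R ∩ S) S) S = R ∩ S :=
  leftOf_rightOf Finset.inter_subset_right fun _ => h.count_succ_lt_of_mem_inter

theorem isFlagTriple (h : IsRowPair n m R S) (hk : m + k = 2 * n) :
    IsFlagTriple n k (R \ (R ∩ S)) (S \ rightOf (R ∩ S) S) (rightOf (R ∩ S) S) := by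
  have hAR : R ∩ S ⊆ R := Finset.inter_subset_left
  have hAS : R ∩ S ⊆ S := Finset.inter_subset_right
  have hB := rightOf_subset (R ∩ S) S
  have hcardB : (rightOf (R ∩ S) S).card = k := by
    rw [card_rightOf hAS fun _ => h.count_succ_lt_of_mem_inter, h.card_inter hk]
  refine ⟨?_, ?_, hcardB, ?_, fun x hx => ?_, fun x hx => ?_⟩
  · rw [Finset.card_sdiff_of_subset hAR, h.card_left, h.card_inter hk]
  · rw [Finset.card_sdiff_of_subset hB, h.card_right, hcardB]
  · rw [Finset.union_assoc, Finset.sdiff_union_of_subset hB, Finset.sdiff_inter_self_left,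
      Finset.sdiff_union_self_eq_union, h.union, show 2 * n - k = m by omega]
  · obtain ⟨hxS, hxB⟩ := Finset.mem_sdiff.1 hx
    have hR := count_sdiff_add hAR x
    have hS := count_sdiff_add hB x
    have hshift := count_rightOf_succ hAS hxS
    rw [Nat.count_succ, if_neg hxB] at hshift
    have hballot := h.isBallot x hxS
    omega
  · have hS := count_sdiff_add hB x
    have hA := count_sdiff_add hAS x
    have hshift := count_rightOf_succ hAS (hB hx)
    rw [Nat.count_succ, if_pos hx] at hshift
    omega

theorem eq_of_flag_eq (h : IsRowPair n m R S) (h' : IsRowPair n m' R' S')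
    (hleft : R \ (R ∩ S) = R' \ (R' ∩ S'))
    (hright : S \ rightOf (R ∩ S) S = S' \ rightOf (R' ∩ S') S')
    (hlower : rightOf (R ∩ S) S = rightOf (R' ∩ S') S') : R = R' ∧ S = S' := by
  have hS : S = S' := by
    rw [← Finset.sdiff_union_of_subset (rightOf_subset (R ∩ S) S), hright, hlower,
      Finset.sdiff_union_of_subset (rightOf_subset (R' ∩ S') S')]
  have hA : R ∩ S = R' ∩ S' := by
    rw [← h.leftOf_rightOf_inter, hlower, hS, h'.leftOf_rightOf_inter]
  refine ⟨?_, hS⟩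
  rw [← Finset.sdiff_union_of_subset (Finset.inter_subset_left : R ∩ S ⊆ R), hleft, hA,
    Finset.sdiff_union_of_subset Finset.inter_subset_left]

end IsRowPair

namespace IsFlagTriple

theorem disjoint (h : IsFlagTriple n k P Q L) (hk : k < n) :
    Disjoint P (Q ∪ L) ∧ Disjoint Q L := by
  have hP := Finset.card_union_add_card_inter P (Q ∪ L)
  have hQ := Finset.card_union_add_card_inter Q L
  rw [← Finset.union_assoc, h.union, Nat.card_Icc, h.card_left] at hP
  rw [h.card_right, h.card_lower] at hQ
  rw [Finset.disjoint_iff_inter_eq_empty, Finset.disjoint_iff_inter_eq_empty,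
    ← Finset.card_eq_zero, ← Finset.card_eq_zero]
  omega

theorem rightOf_leftOf_lower (h : IsFlagTriple n k P Q L) :
    rightOf (leftOf L (Q ∪ L)) (Q ∪ L) = L :=
  rightOf_leftOf Finset.subset_union_right fun x hx =>
    (h.count_pos x hx).trans_le (Nat.count_mono_left fun _ _ => Finset.mem_union_left L)

theorem card_leftOf_lower (h : IsFlagTriple n k P Q L) : (leftOf L (Q ∪ L)).card = k := by
  rw [← card_rightOf (leftOf_subset L (Q ∪ L)), h.rightOf_leftOf_lower, h.card_lower]
  intro x hx
  obtain ⟨-, y, hy, hyx⟩ := mem_leftOf.1 hx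
  rw [← hyx]
  exact count_lt_card (Finset.mem_union_right Q hy)

theorem isBallot_union (h : IsFlagTriple n k P Q L) (hk : k < n) :
    IsBallot (P ∪ leftOf L (Q ∪ L)) (Q ∪ L) := by
  obtain ⟨hdP, hdQ⟩ := h.disjoint hk
  have hA := leftOf_subset L (Q ∪ L)
  intro x hx
  have hR := count_sdiff_add (X := P ∪ leftOf L (Q ∪ L)) Finset.subset_union_right x
  have hS := count_sdiff_add (X := Q ∪ L) Finset.subset_union_right x
  rw [Finset.union_sdiff_cancel_right (Finset.disjoint_of_subset_right hA hdP)] at hR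
  rw [Finset.union_sdiff_cancel_right hdQ] at hS
  have hshift := count_rightOf_succ hA hx
  rw [h.rightOf_leftOf_lower, Nat.count_succ] at hshift
  by_cases hxL : x ∈ L
  · rw [if_pos hxL] at hshift
    have hle := h.isBallot.count_le x
    omega
  · rw [if_neg hxL] at hshift
    have hlt := h.isBallot x ((Finset.mem_union.1 hx).resolve_right hxL)
    omega

theorem exists_isRowPair (h : IsFlagTriple n k P Q L) (hk : k < n) :
    ∃ R S, IsRowPair n (2 * n - k) R S ∧ R \ (R ∩ S) = P ∧ S \ rightOf (R ∩ S) S = Q ∧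
      rightOf (R ∩ S) S = L := by
  obtain ⟨hdP, hdQ⟩ := h.disjoint hk
  have hA := leftOf_subset L (Q ∪ L)
  have hdA := Finset.disjoint_of_subset_right hA hdP
  have hRS : (P ∪ leftOf L (Q ∪ L)) ∩ (Q ∪ L) = leftOf L (Q ∪ L) := by
    rw [Finset.union_inter_distrib_right, Finset.disjoint_iff_inter_eq_empty.1 hdP,
      Finset.empty_union, Finset.inter_eq_left.2 hA]
  refine ⟨P ∪ leftOf L (Q ∪ L), Q ∪ L, ⟨?_, ?_, ?_, h.isBallot_union hk⟩, ?_, ?_, ?_⟩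
  · rw [Finset.card_union_of_disjoint hdA, h.card_left, h.card_leftOf_lower]
    omega
  · rw [Finset.card_union_of_disjoint hdQ, h.card_right, h.card_lower]
    omega
  · rw [Finset.union_assoc, Finset.union_eq_right.2 hA, ← Finset.union_assoc, h.union]
  · rw [hRS, Finset.union_sdiff_cancel_right hdA]
  · rw [hRS, h.rightOf_leftOf_lower, Finset.union_sdiff_cancel_right hdQ]
  · rw [hRS, h.rightOf_leftOf_lower]

end IsFlagTriple

theorem IsIncreasing.rightOfDoubled_eq {T : SemistandardYoungTableau (twoRow n)}
    (hT : IsIncreasing T) : rightOfDoubled T = rightOf (doubled T) (rowEntries T 1) := by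
  have hcount : ∀ j < n, Nat.count (· ∈ rowEntries T 1) (T 1 j) = j := fun j hj => by
    rw [← hT.isRowStrict.nth_rowEntries (by rwa [rowLen_twoRow one_lt_two]),
      count_nth_finset (by rwa [hT.isRowPair.card_right])]
  ext x
  simp only [rightOfDoubled, mem_rightOf, Finset.mem_image, Finset.mem_filter,
    YoungDiagram.mem_row_iff, Prod.exists, mem_twoRow, mem_rowEntries]
  constructor
  · rintro ⟨i, j, ⟨⟨⟨-, hj⟩, rfl⟩, hj1, hA⟩, rfl⟩
    obtain ⟨j, rfl⟩ := Nat.exists_eq_add_of_le' hj1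
    refine ⟨⟨j + 1, ⟨one_lt_two, hj⟩, rfl⟩, T 1 j, hA, ?_⟩
    rw [hcount _ hj, hcount j (by omega)]
  · rintro ⟨⟨j, ⟨-, hj⟩, rfl⟩, y, hy, hjy⟩
    obtain ⟨i, hi, rfl⟩ := mem_rowEntries.1 (Finset.mem_inter.1 hy).2
    rw [hcount j hj, hcount i (mem_twoRow.1 hi).2] at hjy
    subst hjy
    exact ⟨1, i + 1, ⟨⟨⟨one_lt_two, hj⟩, rfl⟩, by omega, hy⟩, rfl⟩

end FlagTriple

/-! ### Standard tableaux of shape `(n - k, n - k, 1, …, 1)` -/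

section Standard

variable {μ : YoungDiagram} {T : SemistandardYoungTableau μ}

theorem bijOn_iff_tabEntries_eq :
    Set.BijOn (fun c : ℕ × ℕ => T c.1 c.2) (μ.cells : Set (ℕ × ℕ)) (Set.Icc 1 μ.card) ↔
      tabEntries T = Finset.Icc 1 μ.card := by
  rw [← Finset.coe_inj, tabEntries, Finset.coe_image, Finset.coe_Icc]
  refine ⟨Set.BijOn.image_eq, fun himage => himage ▸ Set.InjOn.bijOn_image ?_⟩
  apply Finset.card_image_iff.1
  rw [← Set.ncard_coe_finset, Finset.coe_image, himage, ← Finset.coe_Icc, Set.ncard_coe_finset,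
    Nat.card_Icc, Nat.add_sub_cancel]

theorem SYT.tabEntries_eq (T : SYT μ) : tabEntries T.1 = Finset.Icc 1 μ.card :=
  bijOn_iff_tabEntries_eq.1 T.2

theorem SYT.isRowStrict (T : SYT μ) : IsRowStrict T.1 := by
  intro i j₁ j₂ hj hc
  refine (T.1.row_weak hj hc).lt_of_ne fun heq => hj.ne ?_
  exact congrArg Prod.snd
    (T.2.injOn (x₁ := (i, j₁)) (x₂ := (i, j₂)) (μ.up_left_mem le_rfl hj.le hc) hc heq)

end Standard

section FlagShape

variable {n k : ℕ} {h : k < n} {P Q L : Finset ℕ}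

theorem mem_flagShape {i j : ℕ} :
    (i, j) ∈ flagShape n k h ↔ i < 2 ∧ j < n - k ∨ 2 ≤ i ∧ i < k + 2 ∧ j = 0 := by
  rw [flagShape, YoungDiagram.mem_ofRowLens]
  simp only [List.length_cons, List.length_replicate]
  rcases i with _ | _ | i <;> simp

theorem rowLen_flagShape {r : ℕ} (hr : r < 2) : (flagShape n k h).rowLen r = n - k :=
  eq_of_forall_lt_iff fun j => by
    rw [← YoungDiagram.mem_iff_lt_rowLen, mem_flagShape]
    omega

theorem rowLen_flagShape_add_two (r : ℕ) :
    (flagShape n k h).rowLen (r + 2) = if r < k then 1 else 0 :=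
  eq_of_forall_lt_iff fun j => by
    rw [← YoungDiagram.mem_iff_lt_rowLen, mem_flagShape]
    split_ifs <;> omega

theorem card_flagShape (h : k < n) : (flagShape n k h).card = 2 * n - k := by
  have hcells : (flagShape n k h).cells =
      Finset.range 2 ×ˢ Finset.range (n - k) ∪ Finset.Ico 2 (k + 2) ×ˢ {0} := by
    ext ⟨i, j⟩
    simp only [YoungDiagram.mem_cells, mem_flagShape, Finset.mem_union, Finset.mem_product,
      Finset.mem_range, Finset.mem_Ico, Finset.mem_singleton, and_assoc]
  have hdisjoint : Disjoint (Finset.range 2) (Finset.Ico 2 (k + 2)) := by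
    rw [Finset.range_eq_Ico]
    exact Finset.Ico_disjoint_Ico_consecutive 0 2 (k + 2)
  rw [YoungDiagram.card, hcells,
    Finset.card_union_of_disjoint (Finset.disjoint_product.2 (.inl hdisjoint))]
  simp only [Finset.card_product, Finset.card_range, Nat.card_Ico, Finset.card_singleton]
  omega

theorem lowerEntries_flagShape (T : SemistandardYoungTableau (flagShape n k h)) :
    lowerEntries T = (Finset.range k).image fun i => T (i + 2) 0 := by
  ext x
  simp only [lowerEntries, Finset.mem_image, Finset.mem_filter, YoungDiagram.mem_cells,
    Finset.mem_range, Prod.exists, mem_flagShape]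
  constructor
  · rintro ⟨i, j, ⟨hc, hi⟩, rfl⟩
    obtain ⟨i, rfl⟩ := Nat.exists_eq_add_of_le' hi
    obtain rfl : j = 0 := by omega
    exact ⟨i, by omega, rfl⟩
  · rintro ⟨i, hi, rfl⟩
    exact ⟨i + 2, 0, by omega, rfl⟩

theorem strictMonoOn_first_column (T : SemistandardYoungTableau (flagShape n k h)) :
    StrictMonoOn (fun i => T (i + 2) 0) (Set.Iio k) := fun i _ j hj hij =>
  T.col_strict (by omega) (mem_flagShape.2 (by have := Set.mem_Iio.1 hj; omega))

theorem card_lowerEntries_flagShape (T : SemistandardYoungTableau (flagShape n k h)) :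
    (lowerEntries T).card = k := by
  rw [lowerEntries_flagShape, card_image_range (strictMonoOn_first_column T)]

/-- The row entries of a tableau of shape `(n - k, n - k, 1, …, 1)` with first row `P`, second row
`Q` and set of lower entries `L`. -/
noncomputable def flagRows (P Q L : Finset ℕ) : ℕ → Finset ℕ
  | 0 => P
  | 1 => Q
  | r + 2 => if r < L.card then {Nat.nth (· ∈ L) r} else ∅

theorem rowEntries_eq_flagRows (T : SemistandardYoungTableau (flagShape n k h)) :
    ∀ r, rowEntries T r = flagRows (rowEntries T 0) (rowEntries T 1) (lowerEntries T) r
  | 0 => rfl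
  | 1 => rfl
  | r + 2 => by
    rw [rowEntries_eq, rowLen_flagShape_add_two, flagRows, card_lowerEntries_flagShape]
    split_ifs with hr
    · rw [lowerEntries_flagShape, nth_image_range (strictMonoOn_first_column T) hr]
      rfl
    · rfl

theorem lowerEntries_eq_of_rowEntries {T : SemistandardYoungTableau (flagShape n k h)}
    (hL : L.card = k) (hT : ∀ r, rowEntries T r = flagRows P Q L r) : lowerEntries T = L := by
  rw [lowerEntries_flagShape, ← image_nth_finset L, hL]
  refine Finset.image_congr fun i hi => ?_
  have hi : i < k := by simpa using hi
  have hmem : T (i + 2) 0 ∈ rowEntries T (i + 2) :=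
    mem_rowEntries.2 ⟨0, mem_flagShape.2 (by omega), rfl⟩
  rw [hT, flagRows, hL, if_pos hi] at hmem
  exact Finset.mem_singleton.1 hmem

theorem isBallot_singleton {R : Finset ℕ} {x : ℕ} : IsBallot R {x} ↔ 0 < Nat.count (· ∈ R) x := by
  have hcount : Nat.count (· = x) x = 0 := Nat.count_of_forall_not fun _ => ne_of_lt
  simp only [IsBallot, Finset.mem_singleton, forall_eq, hcount]

theorem SYT.ext_parts {T T' : SYT (flagShape n k h)} (h0 : rowEntries T.1 0 = rowEntries T'.1 0)
    (h1 : rowEntries T.1 1 = rowEntries T'.1 1) (h2 : lowerEntries T.1 = lowerEntries T'.1) :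
    T = T' :=
  Subtype.ext <| T.isRowStrict.ext_rowEntries T'.isRowStrict fun r => by
    rw [rowEntries_eq_flagRows, h0, h1, h2, ← rowEntries_eq_flagRows]

theorem SYT.isFlagTriple (T : SYT (flagShape n k h)) :
    IsFlagTriple n k (rowEntries T.1 0) (rowEntries T.1 1) (lowerEntries T.1) where
  card_left := by rw [T.isRowStrict.card_rowEntries, rowLen_flagShape two_pos]
  card_right := by rw [T.isRowStrict.card_rowEntries, rowLen_flagShape one_lt_two]
  card_lower := card_lowerEntries_flagShape T.1
  union := by rw [← tabEntries_eq_union, T.tabEntries_eq, card_flagShape]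
  isBallot := T.isRowStrict.isBallot 0
  count_pos x hx := by
    rw [lowerEntries_flagShape] at hx
    obtain ⟨i, hi, rfl⟩ := Finset.mem_image.1 hx
    have hc : (i + 2, 0) ∈ flagShape n k h := mem_flagShape.2 (by simpa using hi)
    have hcount := Nat.count_strict_mono (p := (· ∈ rowEntries T.1 1))
      (mem_rowEntries.2 ⟨0, mem_flagShape.2 (by omega), rfl⟩)
      (T.1.col_strict (i1 := 1) (by omega) hc)
    exact (Nat.zero_le _).trans_lt hcount

namespace IsFlagTriple

theorem card_flagRows (hF : IsFlagTriple n k P Q L) :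
    ∀ r, (flagRows P Q L r).card = (flagShape n k h).rowLen r
  | 0 => by rw [rowLen_flagShape two_pos, flagRows, hF.card_left]
  | 1 => by rw [rowLen_flagShape one_lt_two, flagRows, hF.card_right]
  | r + 2 => by
    rw [rowLen_flagShape_add_two, flagRows, hF.card_lower]
    split_ifs <;> simp

theorem isBallot_flagRows (hF : IsFlagTriple n k P Q L) :
    ∀ r, IsBallot (flagRows P Q L r) (flagRows P Q L (r + 1))
  | 0 => hF.isBallot
  | 1 => by
    simp only [flagRows]
    split_ifs with hL
    · exact isBallot_singleton.2 (hF.count_pos _ (nth_mem_finset hL))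
    · simp [IsBallot]
  | r + 2 => by
    simp only [flagRows]
    by_cases hL : r + 1 < L.card
    · rw [if_pos hL, if_pos (by omega)]
      refine isBallot_singleton.2 ((Nat.zero_le _).trans_lt
        (Nat.count_strict_mono (Finset.mem_singleton_self _) (nth_lt_nth_finset r.lt_succ_self hL)))
    · simp [IsBallot, if_neg hL]

theorem exists_tableau (hF : IsFlagTriple n k P Q L) (h : k < n) :
    ∃ T : SYT (flagShape n k h),
      rowEntries T.1 0 = P ∧ rowEntries T.1 1 = Q ∧ lowerEntries T.1 = L := by
  obtain ⟨T, -, hrows⟩ :=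
    exists_isRowStrict_of_isBallot (hF.card_flagRows (h := h)) hF.isBallot_flagRows
  have hlower : lowerEntries T = L := lowerEntries_eq_of_rowEntries hF.card_lower hrows
  refine ⟨⟨T, bijOn_iff_tabEntries_eq.2 ?_⟩, hrows 0, hrows 1, hlower⟩
  rw [tabEntries_eq_union, hrows, hrows, hlower, card_flagShape]
  exact hF.union

end IsFlagTriple

end FlagShape

section FlagEquiv

variable {n k : ℕ} {h : k < n} {T T' : Inc (twoRow n) k} {S : SYT (flagShape n k h)}

theorem exists_isFlagOf (h : k < n) (T : Inc (twoRow n) k) :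
    ∃ S : SYT (flagShape n k h), IsFlagOf T.1 S.1 := by
  obtain ⟨S, hS⟩ := (T.2.1.isRowPair.isFlagTriple (T.2.2.trans (card_twoRow n))).exists_tableau h
  exact ⟨S, by rwa [IsFlagOf, T.2.1.rightOfDoubled_eq]⟩

theorem exists_isFlagOf_left (S : SYT (flagShape n k h)) :
    ∃ T : Inc (twoRow n) k, IsFlagOf T.1 S.1 := by
  obtain ⟨R, R', hpair, hleft, hright, hlower⟩ := S.isFlagTriple.exists_isRowPair h
  obtain ⟨T, hT, hm, rfl, rfl⟩ := hpair.exists_tableau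
  refine ⟨⟨T, hT, by rw [hm, card_twoRow]; omega⟩, ?_⟩
  rw [IsFlagOf, hT.rightOfDoubled_eq]
  exact ⟨hleft.symm, hright.symm, hlower.symm⟩

theorem IsFlagOf.eq_right {S' : SYT (flagShape n k h)} (hS : IsFlagOf T.1 S.1)
    (hS' : IsFlagOf T.1 S'.1) : S = S' :=
  SYT.ext_parts (hS.1.trans hS'.1.symm) (hS.2.1.trans hS'.2.1.symm) (hS.2.2.trans hS'.2.2.symm)

theorem IsFlagOf.eq_left (hT : IsFlagOf T.1 S.1) (hT' : IsFlagOf T'.1 S.1) : T = T' := by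
  rw [IsFlagOf, T.2.1.rightOfDoubled_eq] at hT
  rw [IsFlagOf, T'.2.1.rightOfDoubled_eq] at hT'
  obtain ⟨h0, h1⟩ := T.2.1.isRowPair.eq_of_flag_eq T'.2.1.isRowPair (hT.1.symm.trans hT'.1)
    (hT.2.1.symm.trans hT'.2.1) (hT.2.2.symm.trans hT'.2.2)
  exact Subtype.ext (T.2.1.ext_rows T'.2.1 h0 h1)

/-- The bijection from increasing tableaux of shape `2 × n` with maximum value `2n - k` to standard
tableaux of shape `(n - k, n - k, 1, …, 1)`, as the one-to-one correspondence `IsFlagOf`. -/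
noncomputable def flagEquiv (h : k < n) : Inc (twoRow n) k ≃ SYT (flagShape n k h) where
  toFun T := (exists_isFlagOf h T).choose
  invFun S := (exists_isFlagOf_left S).choose
  left_inv T := (exists_isFlagOf_left _).choose_spec.eq_left (exists_isFlagOf h T).choose_spec
  right_inv S := (exists_isFlagOf h _).choose_spec.eq_right (exists_isFlagOf_left S).choose_spec

theorem isFlagOf_flagEquiv (h : k < n) (T : Inc (twoRow n) k) : IsFlagOf T.1 (flagEquiv h T).1 :=
  (exists_isFlagOf h T).choose_spec

end FlagEquiv

theorem theorem1p1 :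
    (∀ (n k : ℕ) (h : k < n),
      (∃ (e : Inc (twoRow n) k ≃ SchroderPathWith n k)
          (f : Inc (twoRow n) k ≃ SYT (flagShape n k h))
          (g : SchroderPathWith n k ≃ SYT (flagShape n k h)),
        (∀ T, (e T).1 = segments T.1) ∧
        (∀ T, IsFlagOf T.1 (f T).1) ∧
        (∀ T, g (e T) = f T)) ∧
      ∑ T : Inc (twoRow n) k, (RatFunc.X : RatFunc ℚ) ^ maj T.1 =
        RatFunc.X ^ (n + (k + 1).choose 2) *
          (qBinom (n - 1) k * qBinom (2 * n - k) (n - k - 1) / qNum (n - k))) ∧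
    (∀ n k : ℕ, 1 ≤ n → n ≤ k →
      IsEmpty (Inc (twoRow n) k) ∧ IsEmpty (SchroderPathWith n k)) ∧
    (∀ n : ℕ, Finite (IncTableau (twoRow n)) ∧ Finite (SchroderPath n) ∧
      Nat.card (IncTableau (twoRow n)) = schroderNumber n) := by
  refine ⟨fun n k h => ⟨⟨schroderEquivWith n k, flagEquiv h,
    (schroderEquivWith n k).symm.trans (flagEquiv h), fun T => rfl, isFlagOf_flagEquiv h,
    fun T => by simp⟩, ?_⟩, fun n k hn hk => ?_, fun n => ?_⟩
  · rw [sum_maj_eq h, flagGF_square h]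
  · have hpaths := isEmpty_schroderPathWith hn hk
    exact ⟨(schroderEquivWith n k).isEmpty, hpaths⟩
  · exact ⟨Finite.of_equiv _ (schroderEquiv n).symm, inferInstance,
      Nat.card_congr (schroderEquiv n)⟩
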